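/- All graphs are finite and simple. Let $\mathcal G$ be the class of connected graphs $G\neq K_4$ of maximum degree at most $3$ on at least three vertices; let $\alpha(G)$ be the independence number of $G$ and $V_i(G)$ the set of its vertices of degree $i$. Let $\mathcal A$ be the smallest class of graphs (up to isomorphism) that contains $K_3$ and that contains, for every $G'\in\mathcal A$ and every vertex $x$ of degree $2$ in $G'$, the graph obtained from the disjoint union of $G'$ and a $K_3$ by adding an edge between $x$ and a vertex of this $K_3$. Let $\mathcal B$ be the class of graphs obtained from a path $P_n$, $n\ge 2$, by adding a pendant edge at every vertex of $P_n$. Let $S_{\mathcal A}$ be the set of pairs $(c_1,c_2)\in\mathbb R^2$ such that $$\alpha(G)\ge c_1|V_1(G)|+c_2|V_2(G)|+\tfrac{1-c_2}{2}|V_3(G)|-(3c_2-1)\quad\text{for all }G\in\mathcal G,$$ let $S_{\mathcal B}$ be the set of pairs $(c_1,c_2)\in\mathbb R^2$ such that $$\alpha(G)\ge c_1|V_1(G)|+c_2|V_2(G)|+(1-c_1)|V_3(G)|-(2c_1+2c_2-2)\quad\text{for all }G\in\mathcal G,$$ and let $S_{\mathcal A\cup\mathcal B}$ be the set of pairs of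 the form $(c_1,2c_1-1)$ in $S_{\mathcal A}\cap S_{\mathcal B}$. Then the following hold. (1) If $\tfrac23\le c_1\le\tfrac57$, then $(c_1,2c_1-1)\in S_{\mathcal A\cup\mathcal B}$; that is, $$\alpha(G)\ge c_1|V_1(G)|+(2c_1-1)|V_2(G)|+(1-c_1)|V_3(G)|-(6c_1-4)$$ for all $G\in\mathcal G$, and equality holds for all $G\in\mathcal A\cup\mathcal B$. (2) If $\tfrac57\le c_1\le 1$, then $(c_1,\tfrac37)\in S_{\mathcal B}$; that is, $$\alpha(G)\ge c_1|V_1(G)|+\tfrac37|V_2(G)|+(1-c_1)|V_3(G)|-\left(2c_1-\tfrac87\right)$$ for all $G\in\mathcal G$, and equality holds for all $G\in\mathcal B$. -/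

import Mathlib

universe u

/-- `V_i(G)`: the vertices `v` of the (finite) graph `G` with `|N_G(v)| = i`. -/
def degreeClass {V : Type u} (G : SimpleGraph V) (i : ℕ) : Set V :=
  {v | (G.neighborSet v).ncard = i}

/-- On a finite graph, `degreeClass` is given by Mathlib's `SimpleGraph.degree`. -/
theorem mem_degreeClass_iff {V : Type u} [Fintype V] (G : SimpleGraph V) [DecidableRel G.Adj]
    (i : ℕ) (v : V) : v ∈ degreeClass G i ↔ G.degree v = i := by
  rw [degreeClass, Set.mem_ofPred_eq, Set.ncard_eq_toFinset_card', Set.toFinset_card,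
    SimpleGraph.card_neighborSet_eq_degree]

/-- The class `𝒢`: finite connected subcubic graphs on at least three vertices that are not
isomorphic to `K_4`. -/
structure ClassG {V : Type u} (G : SimpleGraph V) : Prop where
  finite : Finite V
  connected : G.Connected
  subcubic : ∀ v : V, (G.neighborSet v).ncard ≤ 3
  three_le_card : 3 ≤ Nat.card V
  ne_K4 : IsEmpty (G ≃g (⊤ : SimpleGraph (Fin 4)))

/-- The disjoint union of `G'` and a triangle, together with an edge between the vertex `x` of `G'`
and the vertex `t` of the triangle. -/
def attachTriangle {V : Type u} (G' : SimpleGraph V) (x : V) (t : Fin 3) :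
    SimpleGraph (V ⊕ Fin 3) :=
  (G' ⊕g (⊤ : SimpleGraph (Fin 3))) ⊔ SimpleGraph.edge (Sum.inl x) (Sum.inr t)

/-- The class `𝒜`, closed under isomorphism: it contains `K_3`, and attaching a triangle by an edge
at a vertex of degree two of a member gives a member. -/
inductive ClassA : ∀ {V : Type u}, SimpleGraph V → Prop
  | triangle {V : Type u} (G : SimpleGraph V) (e : G ≃g (⊤ : SimpleGraph (Fin 3))) : ClassA G
  | attach {V' V : Type u} (G' : SimpleGraph V') (h : ClassA G') (x : V')
      (hx : x ∈ degreeClass G' 2) (t : Fin 3) (G : SimpleGraph V)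
      (e : G ≃g attachTriangle G' x t) : ClassA G

/-- The path `P_n` (on the left summand) with a pendant edge added at every vertex. -/
def pendantPath (n : ℕ) : SimpleGraph (Fin n ⊕ Fin n) where
  Adj a b := match a, b with
    | Sum.inl i, Sum.inl j => (SimpleGraph.pathGraph n).Adj i j
    | Sum.inl i, Sum.inr j => i = j
    | Sum.inr i, Sum.inl j => i = j
    | Sum.inr _, Sum.inr _ => False
  symm := ⟨by
    rintro (i | i) (j | j) h
    · exact SimpleGraph.Adj.symm h
    · exact Eq.symm h
    · exact Eq.symm h
    · exact h⟩
  loopless := ⟨by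
    rintro (i | i) h
    · exact SimpleGraph.irrefl _ h
    · exact h⟩

/-- The class `ℬ`, closed under isomorphism. -/
def ClassB {V : Type u} (G : SimpleGraph V) : Prop :=
  ∃ n : ℕ, 2 ≤ n ∧ Nonempty (G ≃g pendantPath n)

/-- `c₁ |V_1(G)| + c₂ |V_2(G)| + c₃ |V_3(G)| - d`. -/
noncomputable def degreeBound (c₁ c₂ c₃ d : ℝ) {V : Type u} (G : SimpleGraph V) : ℝ :=
  c₁ * ((degreeClass G 1).ncard : ℝ) + c₂ * ((degreeClass G 2).ncard : ℝ)
    + c₃ * ((degreeClass G 3).ncard : ℝ) - d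

/-- The set `S_𝒜` of pairs `(c₁, c₂)`. -/
def SA : Set (ℝ × ℝ) :=
  {c | ∀ (V : Type u) (G : SimpleGraph V), ClassG G →
    (G.indepNum : ℝ) ≥ degreeBound c.1 c.2 ((1 - c.2) / 2) (3 * c.2 - 1) G}

/-- The set `S_ℬ` of pairs `(c₁, c₂)`. -/
def SB : Set (ℝ × ℝ) :=
  {c | ∀ (V : Type u) (G : SimpleGraph V), ClassG G →
    (G.indepNum : ℝ) ≥ degreeBound c.1 c.2 (1 - c.1) (2 * c.1 + 2 * c.2 - 2) G}

/-- The set `S_{𝒜 ∪ ℬ}` of the pairs `(c₁, 2c₁ - 1)` that lie in `S_𝒜 ∩ S_ℬ`. -/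
def SAB : Set (ℝ × ℝ) :=
  {c | c ∈ SA.{u} ∩ SB.{u} ∧ c.2 = 2 * c.1 - 1}

set_option linter.unusedSectionVars false

open Finset

namespace SimpleGraph

section FinsetConnectivity

variable {V : Type*} [DecidableEq V] (G : SimpleGraph V)

/-- The subgraph induced by the finite set `S` is connected (or `S` is empty): every proper nonempty
subset of `S` sends an edge to the rest of `S`. -/
def ConnOn (S : Finset V) : Prop :=
  ∀ A ⊆ S, A.Nonempty → A ≠ S → ∃ a ∈ A, ∃ b ∈ S, b ∉ A ∧ G.Adj a b

variable {G}

theorem connOn_singleton (x : V) : G.ConnOn {x} := by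
  intro A hA hne hAS
  rcases Finset.subset_singleton_iff.1 hA with h | h
  · exact absurd h hne.ne_empty
  · exact absurd h hAS

theorem ConnOn.insert_adj {S : Finset V} (hS : G.ConnOn S) {x y : V} (hx : x ∈ S) (hxy : G.Adj x y) :
    G.ConnOn (insert y S) := by
  by_cases hy : y ∈ S
  · rwa [Finset.insert_eq_of_mem hy]
  intro A hA hne hAS
  by_cases hyA : y ∈ A
  · by_cases hxA : x ∈ A
    · have h1 : A.erase y ⊆ S := fun z hz => by
        have := hA (Finset.mem_of_mem_erase hz)
        grind
      have h2 : A.erase y ≠ S := by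
        rintro rfl
        exact hAS (Finset.insert_erase hyA).symm
      obtain ⟨a, ha, b, hb, hbA, hab⟩ := hS _ h1 ⟨x, by grind⟩ h2
      exact ⟨a, by grind, b, by grind, by grind, hab⟩
    · exact ⟨y, hyA, x, by grind, hxA, hxy.symm⟩
  · have h1 : A ⊆ S := by grind
    by_cases hAS' : A = S
    · exact ⟨x, by grind, y, by grind, hyA, hxy⟩
    · obtain ⟨a, ha, b, hb, hbA, hab⟩ := hS _ h1 hne hAS'
      exact ⟨a, ha, b, by grind, hbA, hab⟩

/-- A connected set with at least two vertices has a vertex other than the given `x` whose removal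
keeps it connected. -/
theorem ConnOn.exists_erase {S : Finset V} (hS : G.ConnOn S) {x : V} (hx : x ∈ S)
    (hcard : 2 ≤ #S) : ∃ y ∈ S, y ≠ x ∧ G.ConnOn (S.erase y) := by
  classical
  obtain ⟨P, hP, hmax⟩ := Finset.exists_max_image
    (S.powerset.filter fun P => G.ConnOn P ∧ x ∈ P ∧ P ≠ S) Finset.card
    ⟨{x}, by
      simp only [Finset.mem_filter, Finset.mem_powerset, Finset.singleton_subset_iff]
      refine ⟨hx, connOn_singleton x, Finset.mem_singleton_self x, ?_⟩
      rintro rfl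
      simp at hcard⟩
  simp only [Finset.mem_filter, Finset.mem_powerset] at hP hmax
  obtain ⟨hPS, hPc, hxP, hPne⟩ := hP
  obtain ⟨a, ha, b, hb, hbP, hab⟩ := hS P hPS ⟨x, hxP⟩ hPne
  have hins : insert b P = S := by
    by_contra hne
    have := hmax (insert b P) ⟨by grind, hPc.insert_adj ha hab, by grind, hne⟩
    rw [Finset.card_insert_of_notMem hbP] at this
    omega
  refine ⟨b, hb, by grind, ?_⟩
  rw [← hins, Finset.erase_insert hbP]
  exact hPc

/-- A minimal nonempty subset without edges to the rest is connected. -/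
theorem exists_component {R : Finset V} (hR : R.Nonempty) :
    ∃ C ⊆ R, C.Nonempty ∧ G.ConnOn C ∧ ∀ x ∈ C, ∀ y ∈ R, y ∉ C → ¬ G.Adj x y := by
  classical
  obtain ⟨C, hC, hmin⟩ := Finset.exists_min_image
    (R.powerset.filter fun C => C.Nonempty ∧ ∀ x ∈ C, ∀ y ∈ R, y ∉ C → ¬ G.Adj x y) Finset.card
    ⟨R, by simp [hR]; grind⟩
  simp only [Finset.mem_filter, Finset.mem_powerset] at hC hmin
  refine ⟨C, hC.1, hC.2.1, ?_, hC.2.2⟩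
  intro A hA hne hAC
  by_contra! hcon
  have := hmin A ⟨hA.trans hC.1, hne, fun x hx y hy hyA => by
    by_cases hyC : y ∈ C
    · exact hcon x hx y hyC hyA
    · exact hC.2.2 x (hA hx) y hy hyC⟩
  exact hAC (Finset.eq_of_subset_of_card_le hA this)

theorem Connected.connOn_univ [Fintype V] (h : G.Connected) : G.ConnOn univ := by
  intro A _ ⟨a, ha⟩ hne
  obtain ⟨b, hb⟩ : ∃ b, b ∉ A := by
    by_contra! hcon
    exact hne (Finset.eq_univ_iff_forall.2 hcon)
  obtain ⟨p⟩ := h.preconnected a b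
  obtain ⟨d, _, h1, h2⟩ := p.exists_boundary_dart (A : Set V) ha hb
  exact ⟨d.fst, h1, d.snd, mem_univ _, h2, d.adj⟩

/-- Independent sets may be collected component by component. -/
theorem exists_indep_of_components (g : V → ℤ) (k : ℤ) (R : Finset V)
    (h : ∀ C ⊆ R, C.Nonempty → G.ConnOn C → (∀ x ∈ C, ∀ y ∈ R, y ∉ C → ¬ G.Adj x y) →
      ∃ I ⊆ C, G.IsIndepSet (I : Set V) ∧ ∑ u ∈ C, g u ≤ k * #I) :
    ∃ I ⊆ R, G.IsIndepSet (I : Set V) ∧ ∑ u ∈ R, g u ≤ k * #I := by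
  induction R using Finset.strongInduction with
  | H R ih =>
    rcases R.eq_empty_or_nonempty with rfl | hR
    · exact ⟨∅, by simp⟩
    obtain ⟨C, hCR, hCne, hC, hcl⟩ := exists_component (G := G) hR
    obtain ⟨I, hIC, hI, hIk⟩ := h C hCR hCne hC hcl
    obtain ⟨J, hJR, hJ, hJk⟩ := ih (R \ C) (Finset.sdiff_ssubset hCR hCne) (by
      intro D hD hDne hDc hDcl
      refine h D (hD.trans Finset.sdiff_subset) hDne hDc fun x hx y hy hyD hxy => ?_
      by_cases hyC : y ∈ C
      · have := hD hx
        exact hcl y hyC x (by grind) (by grind) hxy.symm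
      · exact hDcl x hx y (by grind) hyD hxy)
    refine ⟨I ∪ J, by grind, ?_, ?_⟩
    · intro x hx y hy hxy hadj
      simp only [Finset.coe_union, Set.mem_union, Finset.mem_coe] at hx hy
      rcases hx with hx | hx <;> rcases hy with hy | hy
      · exact hI hx hy hxy hadj
      · have := hJR hy
        exact hcl x (hIC hx) y (by grind) (by grind) hadj
      · have := hJR hx
        exact hcl y (hIC hy) x (by grind) (by grind) hadj.symm
      · exact hJ hx hy hxy hadj
    · have hdisj : Disjoint I J := by
        rw [Finset.disjoint_left]
        intro x hx hx'
        have := hJR hx'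
        have := hIC hx
        grind
      rw [Finset.card_union_of_disjoint hdisj, ← Finset.sum_sdiff hCR]
      push_cast
      linarith

end FinsetConnectivity

section DegreeInFinset

variable {V : Type*} [DecidableEq V] (G : SimpleGraph V) [DecidableRel G.Adj]

/-- The number of neighbours of `v` in the finite set `S`. -/
def degIn (S : Finset V) (v : V) : ℕ := #{u ∈ S | G.Adj v u}

/-- The number of pairs `(x, y)` of adjacent vertices with `x ∈ A` and `y ∈ B`. -/
def edgesBetween (A B : Finset V) : ℕ := ∑ x ∈ A, G.degIn B x

variable {G}

theorem degIn_mono {S T : Finset V} (h : S ⊆ T) (v : V) : G.degIn S v ≤ G.degIn T v :=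
  Finset.card_le_card (Finset.filter_subset_filter _ h)

theorem degIn_pos {S : Finset V} {v : V} : 0 < G.degIn S v ↔ ∃ u ∈ S, G.Adj v u := by
  simp [degIn, Finset.card_pos, Finset.Nonempty]

theorem degIn_eq_zero {S : Finset V} {v : V} : G.degIn S v = 0 ↔ ∀ u ∈ S, ¬ G.Adj v u := by
  simp [degIn, Finset.filter_eq_empty_iff]

theorem degIn_union {S T : Finset V} (h : Disjoint S T) (v : V) :
    G.degIn (S ∪ T) v = G.degIn S v + G.degIn T v := by
  rw [degIn, Finset.filter_union, Finset.card_union_of_disjoint]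
  · rfl
  · exact Finset.disjoint_filter_filter h

theorem degIn_sdiff_add {S T : Finset V} (h : S ⊆ T) (v : V) :
    G.degIn S v + G.degIn (T \ S) v = G.degIn T v := by
  rw [← degIn_union Finset.disjoint_sdiff, Finset.union_sdiff_of_subset h]

theorem degIn_lt_of_adj {S T : Finset V} (h : S ⊆ T) {v u : V} (hu : u ∈ T) (huS : u ∉ S)
    (hvu : G.Adj v u) : G.degIn S v < G.degIn T v := by
  apply Finset.card_lt_card
  refine ⟨Finset.filter_subset_filter _ h, fun hcon => ?_⟩
  have := hcon (Finset.mem_filter.2 ⟨hu, hvu⟩)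
  grind

theorem edgesBetween_comm (A B : Finset V) : G.edgesBetween A B = G.edgesBetween B A := by
  have h := Finset.sum_card_bipartiteAbove_eq_sum_card_bipartiteBelow (s := A) (t := B) G.Adj
  simp only [Finset.bipartiteAbove, Finset.bipartiteBelow] at h
  simp only [edgesBetween, degIn, h, G.adj_comm]

theorem edgesBetween_mono {A B A' B' : Finset V} (hA : A ⊆ A') (hB : B ⊆ B') :
    G.edgesBetween A B ≤ G.edgesBetween A' B' :=
  (Finset.sum_le_sum fun x _ => degIn_mono hB x).trans
    (Finset.sum_le_sum_of_subset hA)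

theorem edgesBetween_union_right {A B C : Finset V} (h : Disjoint B C) :
    G.edgesBetween A (B ∪ C) = G.edgesBetween A B + G.edgesBetween A C := by
  simp only [edgesBetween, degIn_union h, Finset.sum_add_distrib]

theorem edgesBetween_union_left {A B C : Finset V} (h : Disjoint A B) :
    G.edgesBetween (A ∪ B) C = G.edgesBetween A C + G.edgesBetween B C := by
  simp only [edgesBetween, Finset.sum_union h]

theorem edgesBetween_pos {A B : Finset V} {x y : V} (hx : x ∈ A) (hy : y ∈ B) (h : G.Adj x y) :
    0 < G.edgesBetween A B :=
  Finset.sum_pos' (fun _ _ => Nat.zero_le _) ⟨x, hx, degIn_pos.2 ⟨y, hy, h⟩⟩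

end DegreeInFinset

section WeightedBound

variable {V : Type*} [DecidableEq V] {G : SimpleGraph V} [DecidableRel G.Adj]

/-- The weight of a vertex of the given degree in the bound for the independence number. -/
def degWeight : ℕ → ℤ
  | 0 => 9
  | 1 => 5
  | 2 => 3
  | _ => 2

theorem degWeight_le_of_two_le {d : ℕ} (h : 2 ≤ d) : degWeight d ≤ 3 := by
  unfold degWeight; split <;> omega

theorem degWeight_of_three_le {d : ℕ} (h : 3 ≤ d) : degWeight d = 2 := by
  unfold degWeight; split <;> omega

theorem degWeight_add_le {k d : ℕ} (hkd : k ≤ d) (hd : d ≤ 3) :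
    degWeight d + d ≤ degWeight k + k := by
  interval_cases d <;> interval_cases k <;> norm_num [degWeight]

/-- Pick a vertex `v`, delete its closed neighbourhood and apply the bound to the components of the
rest. -/
theorem exists_indep_of_removal {S : Finset V} {v : V} (hv : v ∈ S) {M : Finset V}
    (hM : M = insert v {u ∈ S | G.Adj v u}) (δ : V → ℤ)
    (hsum : ∑ u ∈ M, degWeight (G.degIn S u) + ∑ u ∈ S \ M, δ u ≤ 9)
    (hcomp : ∀ C ⊆ S \ M, C.Nonempty → G.ConnOn C →
      (∀ x ∈ C, ∀ y ∈ S \ M, y ∉ C → ¬ G.Adj x y) →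
      2 + (if #C = 2 then 1 else 0) + ∑ u ∈ C, degWeight (G.degIn S u) ≤
        ∑ u ∈ C, degWeight (G.degIn C u) + ∑ u ∈ C, δ u)
    (ih : ∀ C ⊂ S, C.Nonempty → G.ConnOn C → ∃ I ⊆ C, G.IsIndepSet (I : Set V) ∧
      ∑ u ∈ C, degWeight (G.degIn C u) ≤ 7 * #I + 2 + (if #C = 2 then 1 else 0)) :
    ∃ I ⊆ S, G.IsIndepSet (I : Set V) ∧ ∑ u ∈ S, degWeight (G.degIn S u) ≤ 7 * #I + 2 := by
  have hMS : M ⊆ S := by grind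
  have hvM : v ∈ M := by grind
  obtain ⟨I, hIR, hI, hIk⟩ := exists_indep_of_components (G := G)
    (fun u => degWeight (G.degIn S u) - δ u) 7 (S \ M) (by
      intro C hC hCne hCc hcl
      have hss : C ⊂ S := ⟨hC.trans Finset.sdiff_subset, fun h => by
        have := hC (h hv)
        grind⟩
      obtain ⟨I, hIC, hI, hIk⟩ := ih C hss hCne hCc
      refine ⟨I, hIC, hI, ?_⟩
      have := hcomp C hC hCne hCc hcl
      rw [Finset.sum_sub_distrib]
      linarith)
  have hvI : v ∉ I := fun h => by
    have := hIR h
    grind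
  refine ⟨insert v I, by grind, ?_, ?_⟩
  · have key : ∀ y ∈ I, ¬ G.Adj v y := by
      intro y hy hvy
      have := hIR hy
      grind
    intro x hx y hy hxy hadj
    simp only [Finset.coe_insert, Set.mem_insert_iff, Finset.mem_coe] at hx hy
    rcases hx with rfl | hx <;> rcases hy with rfl | hy
    · exact hxy rfl
    · exact key y hy hadj
    · exact key x hx hadj.symm
    · exact hI hx hy hxy hadj
  · rw [Finset.card_insert_of_notMem hvI, ← Finset.sum_sdiff hMS]
    rw [Finset.sum_sub_distrib] at hIk
    push_cast
    linarith

theorem ConnOn.degIn_pos {S : Finset V} (hS : G.ConnOn S) (hcard : 2 ≤ #S) {v : V} (hv : v ∈ S) :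
    0 < G.degIn S v := by
  obtain ⟨a, ha, b, hb, _, hab⟩ := hS {v} (by simpa) ⟨v, by simp⟩ (by
    rintro rfl
    simp at hcard)
  rw [Finset.mem_singleton] at ha
  subst ha
  exact SimpleGraph.degIn_pos.2 ⟨b, hb, hab⟩

theorem degIn_lt_card {S : Finset V} {v : V} (hv : v ∈ S) : G.degIn S v < #S := by
  apply Finset.card_lt_card
  refine ⟨Finset.filter_subset _ _, fun h => ?_⟩
  have := h hv
  simp at this

theorem ConnOn.degIn_eq_one {S : Finset V} (hS : G.ConnOn S) (hcard : #S = 2) {v : V}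
    (hv : v ∈ S) : G.degIn S v = 1 := by
  have h1 := hS.degIn_pos hcard.ge hv
  have h2 := degIn_lt_card (G := G) hv
  omega

/-- The degrees in `S` and in a component `C` of `S \ M` differ by the number of neighbours
in `M`. -/
theorem degIn_component {S M C : Finset V} (hM : M ⊆ S) (hC : C ⊆ S \ M)
    (hcl : ∀ x ∈ C, ∀ y ∈ S \ M, y ∉ C → ¬ G.Adj x y) {x : V} (hx : x ∈ C) :
    G.degIn S x = G.degIn C x + G.degIn M x := by
  have hdis : Disjoint C M := by
    rw [Finset.disjoint_left]
    intro z hz hz'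
    have := hC hz
    grind
  rw [← degIn_union hdis]
  unfold degIn
  congr 1
  ext y
  simp only [Finset.mem_filter, Finset.mem_union]
  refine ⟨fun ⟨h1, h2⟩ => ⟨?_, h2⟩, fun ⟨h1, h2⟩ => ⟨?_, h2⟩⟩
  · by_contra! h
    exact hcl x hx y (by grind) h.1 h2
  · rcases h1 with h | h
    · exact (Finset.mem_sdiff.1 (hC h)).1
    · exact hM h

theorem exists_edge_of_component {S M C : Finset V} (hS : G.ConnOn S)
    (hMne : M.Nonempty) (hM : M ⊆ S) (hC : C ⊆ S \ M) (hCne : C.Nonempty)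
    (hcl : ∀ x ∈ C, ∀ y ∈ S \ M, y ∉ C → ¬ G.Adj x y) :
    ∃ x ∈ C, ∃ y ∈ M, G.Adj x y := by
  obtain ⟨x, hx, y, hy, hyC, hxy⟩ := hS C (hC.trans Finset.sdiff_subset) hCne (by
    rintro rfl
    obtain ⟨m, hm⟩ := hMne
    have := hC (hM hm)
    grind)
  refine ⟨x, hx, y, ?_, hxy⟩
  by_contra hyM
  exact hcl x hx y (by grind) hyC hxy

/-- The inductive step at a vertex of degree one. -/
theorem exists_indep_of_leaf (hG : ∀ (S : Finset V) (v : V), G.degIn S v ≤ 3) {S : Finset V}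
    (hS : G.ConnOn S) (hcard : 3 ≤ #S) {v : V} (hv : v ∈ S) (hdeg : G.degIn S v = 1)
    (ih : ∀ C ⊂ S, C.Nonempty → G.ConnOn C → ∃ I ⊆ C, G.IsIndepSet (I : Set V) ∧
      ∑ u ∈ C, degWeight (G.degIn C u) ≤ 7 * #I + 2 + (if #C = 2 then 1 else 0)) :
    ∃ I ⊆ S, G.IsIndepSet (I : Set V) ∧ ∑ u ∈ S, degWeight (G.degIn S u) ≤ 7 * #I + 2 := by
  obtain ⟨u, hu⟩ := Finset.card_eq_one.1 hdeg
  have huS : u ∈ S ∧ G.Adj v u := by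
    have : u ∈ ({u} : Finset V) := by simp
    rw [← hu] at this
    simpa using this
  have honly : ∀ x ∈ S, G.Adj v x → x = u := by
    intro x hx hvx
    have : x ∈ ({u} : Finset V) := by
      rw [← hu]
      simp [hx, hvx]
    simpa using this
  have huv : v ≠ u := huS.2.ne
  have hM : ({v, u} : Finset V) = insert v {u ∈ S | G.Adj v u} := by rw [hu]
  have hMS : ({v, u} : Finset V) ⊆ S := by grind
  have hdu : 2 ≤ G.degIn S u := by
    obtain ⟨x, hx, y, hy, hyM, hxy⟩ := hS {v, u} hMS ⟨v, by simp⟩ (by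
      rintro rfl
      have := Finset.card_le_two (a := v) (b := u)
      omega)
    have hxu : x = u := by
      rcases Finset.mem_insert.1 hx with rfl | h
      · have := honly y hy hxy
        grind
      · simpa using h
    subst hxu
    have : #({v, y} : Finset V) ≤ G.degIn S x := by
      apply Finset.card_le_card
      have := huS.2.symm
      grind
    rwa [Finset.card_pair (by grind)] at this
  have hcases : ∀ x ∈ S \ {v, u}, G.degIn {v, u} x = if G.Adj u x then 1 else 0 := by
    intro x hx
    have hvx : ¬ G.Adj x v := fun h => by
      have := honly x (by grind) h.symm
      grind
    rw [degIn, Finset.filter_insert, if_neg hvx, Finset.filter_singleton]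
    by_cases h : G.Adj u x
    · simp [h, h.symm]
    · have h' : ¬ G.Adj x u := fun h' => h h'.symm
      simp [h, h']
  refine exists_indep_of_removal hv hM (fun x => if G.Adj u x then 1 else 0) ?_ ?_ ih
  · have h1 : ∑ x ∈ S \ {v, u}, (if G.Adj u x then (1 : ℤ) else 0) = G.degIn S u - 1 := by
      rw [Finset.sum_boole]
      have h2 : {x ∈ S | G.Adj u x} = insert v {x ∈ S \ {v, u} | G.Adj u x} := by
        have := huS.2.symm
        have : ¬ G.Adj u u := G.irrefl
        grind
      rw [degIn, h2, Finset.card_insert_of_notMem (by grind)]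
      push_cast
      ring
    rw [h1, Finset.sum_pair huv, hdeg]
    have h3 := hG S u
    have : G.degIn S u = 2 ∨ G.degIn S u = 3 := by omega
    rcases this with h | h <;> rw [h] <;> norm_num [degWeight]
  · intro C hC hCne hCc hcl
    obtain ⟨x₀, hx₀, y, hy, hxy⟩ := exists_edge_of_component hS ⟨v, by simp⟩ hMS hC hCne hcl
    have hstep : ∀ x ∈ C, (0 : ℤ) ≤ degWeight (G.degIn C x) + (if G.Adj u x then 1 else 0)
        - degWeight (G.degIn S x) := by
      intro x hx
      have h1 := degIn_component hMS hC hcl hx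
      rw [hcases x (hC hx)] at h1
      have h2 := degWeight_add_le (h1 ▸ Nat.le_add_right _ _ : G.degIn C x ≤ G.degIn S x) (hG S x)
      rw [h1] at h2 ⊢
      split_ifs at h2 ⊢ <;> push_cast at h2 <;> linarith
    have hbig : (2 : ℤ) + (if #C = 2 then 1 else 0) ≤ degWeight (G.degIn C x₀) +
        (if G.Adj u x₀ then 1 else 0) - degWeight (G.degIn S x₀) := by
      have h1 := degIn_component hMS hC hcl hx₀
      have h3 : 0 < G.degIn {v, u} x₀ := SimpleGraph.degIn_pos.2 ⟨y, hy, hxy⟩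
      rw [hcases x₀ (hC hx₀)] at h1 h3
      have hux : G.Adj u x₀ := by
        by_contra h
        simp [h] at h3
      rw [if_pos hux] at h1 ⊢
      have h2 := degWeight_add_le (h1 ▸ Nat.le_add_right _ _ : G.degIn C x₀ ≤ G.degIn S x₀)
        (hG S x₀)
      split_ifs with hC2
      · have h4 := hCc.degIn_eq_one hC2 hx₀
        rw [h1, h4]
        norm_num [degWeight]
      · rw [h1] at h2 ⊢
        push_cast at h2
        linarith
    have := Finset.single_le_sum hstep hx₀
    rw [Finset.sum_sub_distrib, Finset.sum_add_distrib] at this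
    linarith

end WeightedBound

section MinDegreeTwo

variable {V : Type*} [DecidableEq V] {G : SimpleGraph V} [DecidableRel G.Adj]

/-- A set `B` sending at most one edge to the rest of `S`, minimal with this property. -/
structure IsMinimalBridgeSide (G : SimpleGraph V) [DecidableRel G.Adj] (S B : Finset V) :
    Prop where
  subset : B ⊆ S
  nonempty : B.Nonempty
  edges_le : G.edgesBetween B (S \ B) ≤ 1
  minimal : ∀ A ⊆ B, A.Nonempty → A ≠ B → 2 ≤ G.edgesBetween A (S \ A)

theorem exists_isMinimalBridgeSide {S : Finset V} (hS : S.Nonempty) :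
    ∃ B, G.IsMinimalBridgeSide S B := by
  obtain ⟨B, hB, hmin⟩ := Finset.exists_min_image
    (S.powerset.filter fun B => B.Nonempty ∧ G.edgesBetween B (S \ B) ≤ 1) Finset.card
    ⟨S, by
      simp only [Finset.mem_filter, Finset.mem_powerset]
      exact ⟨Finset.Subset.refl S, hS, by simp [edgesBetween, degIn]⟩⟩
  simp only [Finset.mem_filter, Finset.mem_powerset] at hB hmin
  refine ⟨B, hB.1, hB.2.1, hB.2.2, fun A hA hAne hAB => ?_⟩
  by_contra! h
  exact hAB (Finset.eq_of_subset_of_card_le hA (hmin A ⟨hA.trans hB.1, hAne, by omega⟩))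

namespace IsMinimalBridgeSide

variable {S B : Finset V}

theorem degIn_add (hB : G.IsMinimalBridgeSide S B) (v : V) :
    G.degIn B v + G.degIn (S \ B) v = G.degIn S v :=
  degIn_sdiff_add hB.subset v

/-- A vertex of `B` with a neighbour outside `B` has degree at least three. -/
theorem not_adj_of_degIn_eq_two (hB : G.IsMinimalBridgeSide S B) {v : V} (hv : v ∈ B)
    (hdeg : G.degIn S v = 2) : ∀ u ∈ S, G.Adj v u → u ∈ B := by
  intro u hu hvu
  by_contra huB
  have h1 : 0 < G.degIn (S \ B) v := SimpleGraph.degIn_pos.2 ⟨u, by grind, hvu⟩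
  have h2 : G.degIn (S \ B) v ≤ G.edgesBetween B (S \ B) :=
    Finset.single_le_sum (f := fun x => G.degIn (S \ B) x) (fun _ _ => Nat.zero_le _) hv
  have h3 := hB.edges_le
  have h4 := hB.degIn_add v
  have hin : G.degIn B v = 1 := by omega
  obtain ⟨w, hw, hvw⟩ : ∃ w ∈ B, G.Adj v w := SimpleGraph.degIn_pos.1 (by omega)
  have hins : insert v (B.erase v) = B := Finset.insert_erase hv
  have h5 := hB.minimal (B.erase v) (Finset.erase_subset _ _)
    ⟨w, Finset.mem_erase.2 ⟨hvw.ne', hw⟩⟩ (by grind)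
  have h6 : S \ B.erase v = (S \ B) ∪ {v} := by
    have := hB.subset hv
    grind
  have h7 : B = {v} ∪ B.erase v := by grind
  have h8 : G.edgesBetween B (S \ B) =
      G.edgesBetween {v} (S \ B) + G.edgesBetween (B.erase v) (S \ B) := by
    conv_lhs => rw [h7]
    rw [edgesBetween_union_left (by simp), ← h7]
  rw [h6, edgesBetween_union_right (by simp [hv])] at h5
  have h9 : G.edgesBetween (B.erase v) {v} ≤ G.degIn B v := by
    rw [edgesBetween_comm]
    simp only [edgesBetween, Finset.sum_singleton]
    exact degIn_mono (Finset.erase_subset _ _) v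
  have h10 : G.edgesBetween {v} (S \ B) = G.degIn (S \ B) v := by simp [edgesBetween]
  omega

theorem exists_forall_adj_mem (hB : G.IsMinimalBridgeSide S B) (h : ∀ v ∈ B, 2 ≤ G.degIn S v) :
    ∃ v ∈ B, ∀ u ∈ S, G.Adj v u → u ∈ B := by
  by_contra! hcon
  have h1 : ∀ v ∈ B, 1 ≤ G.degIn (S \ B) v := fun v hv => by
    obtain ⟨u, hu, hvu, huB⟩ := hcon v hv
    exact SimpleGraph.degIn_pos.2 ⟨u, by grind, hvu⟩
  have h2 : #B ≤ G.edgesBetween B (S \ B) := by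
    simpa [edgesBetween] using Finset.card_nsmul_le_sum B _ 1 h1
  obtain ⟨v, hv⟩ := hB.nonempty
  have h3 := h v hv
  have h4 := hB.degIn_add v
  have h5 := degIn_lt_card (G := G) hv
  have h6 : G.degIn (S \ B) v ≤ G.edgesBetween B (S \ B) :=
    Finset.single_le_sum (f := fun x => G.degIn (S \ B) x) (fun _ _ => Nat.zero_le _) hv
  have h7 := hB.edges_le
  omega

/-- A connected set joined to the rest of `S` by at most one edge and missing a vertex of `B` is
disjoint from `B`. -/
theorem disjoint_of_edges_le (hB : G.IsMinimalBridgeSide S B) {C : Finset V} (hCS : C ⊆ S)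
    (hC : G.ConnOn C) (hCe : G.edgesBetween C (S \ C) ≤ 1) {v : V} (hv : v ∈ B) (hvC : v ∉ C) :
    Disjoint C B := by
  by_contra hdis
  have hne : (C ∩ B).Nonempty := by
    rwa [Finset.nonempty_iff_ne_empty, ne_eq, ← Finset.disjoint_iff_inter_eq_empty]
  by_cases hCB : C ⊆ B
  · have := hB.minimal C hCB (hne.mono Finset.inter_subset_left) (by grind)
    omega
  · obtain ⟨p, hp, q, hq, hqB, hpq⟩ := hC (C ∩ B) Finset.inter_subset_left hne (by grind)
    have h1 := hB.minimal (B \ C) Finset.sdiff_subset ⟨v, by grind⟩ (by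
      intro h
      have : p ∈ B \ C := by grind
      grind)
    have hSB := hB.subset
    have h2 : S \ (B \ C) = (S \ B) ∪ (C ∩ B) := by grind
    rw [h2, edgesBetween_union_right (by
      rw [Finset.disjoint_left]; grind)] at h1
    have h3 : G.edgesBetween B (S \ B) =
        G.edgesBetween (B \ C) (S \ B) + G.edgesBetween (C ∩ B) (S \ B) := by
      rw [← edgesBetween_union_left (by rw [Finset.disjoint_left]; grind)]
      congr 1
      grind
    have h4 : 0 < G.edgesBetween (C ∩ B) (S \ B) := edgesBetween_pos hp (by grind) hpq
    have h5 : G.edgesBetween (B \ C) (C ∩ B) ≤ G.edgesBetween C (S \ C) := by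
      rw [edgesBetween_comm]
      exact edgesBetween_mono Finset.inter_subset_left (by grind)
    have h6 := hB.edges_le
    omega

end IsMinimalBridgeSide

/-- The inductive step when there are no vertices of degree one. -/
theorem exists_indep_of_two_le_degIn (hG : ∀ (S : Finset V) (v : V), G.degIn S v ≤ 3)
    {S : Finset V} (hS : G.ConnOn S) (hne : S.Nonempty) (hmin : ∀ v ∈ S, 2 ≤ G.degIn S v)
    (ih : ∀ C ⊂ S, C.Nonempty → G.ConnOn C → ∃ I ⊆ C, G.IsIndepSet (I : Set V) ∧
      ∑ u ∈ C, degWeight (G.degIn C u) ≤ 7 * #I + 2 + (if #C = 2 then 1 else 0)) :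
    ∃ I ⊆ S, G.IsIndepSet (I : Set V) ∧ ∑ u ∈ S, degWeight (G.degIn S u) ≤ 7 * #I + 2 := by
  obtain ⟨B, hB⟩ := exists_isMinimalBridgeSide (G := G) hne
  have hBS := hB.subset
  obtain ⟨v, hvB, hvadj, hsum⟩ : ∃ v ∈ B, (∀ u ∈ S, G.Adj v u → u ∈ B) ∧
      (∑ u ∈ insert v {u ∈ S | G.Adj v u}, degWeight (G.degIn S u) ≤ 8 ∨
        (∑ u ∈ insert v {u ∈ S | G.Adj v u}, degWeight (G.degIn S u) ≤ 9 ∧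
          G.edgesBetween (insert v {u ∈ S | G.Adj v u}) (S \ B) = 0)) := by
    by_cases h2 : ∃ v ∈ B, G.degIn S v = 2
    · obtain ⟨v, hv, hdeg⟩ := h2
      have hadj := hB.not_adj_of_degIn_eq_two hv hdeg
      refine ⟨v, hv, hadj, ?_⟩
      rw [Finset.sum_insert (by simp), hdeg]
      have hle : ∀ u ∈ {u ∈ S | G.Adj v u}, degWeight (G.degIn S u) ≤ 3 := fun u hu =>
        degWeight_le_of_two_le (hmin u (Finset.mem_filter.1 hu).1)
      have hsum := Finset.sum_le_card_nsmul _ _ _ hle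
      have hcard : #{u ∈ S | G.Adj v u} = 2 := hdeg
      rw [hcard] at hsum
      by_cases h3 : ∃ u ∈ {u ∈ S | G.Adj v u}, G.degIn S u ≠ 2
      · left
        obtain ⟨u, hu, hdu⟩ := h3
        have hlt : ∑ u ∈ {u ∈ S | G.Adj v u}, degWeight (G.degIn S u) <
            ∑ u ∈ {u ∈ S | G.Adj v u}, (3 : ℤ) := by
          refine Finset.sum_lt_sum hle ⟨u, hu, ?_⟩
          have := hmin u (Finset.mem_filter.1 hu).1
          rw [degWeight_of_three_le (by omega)]
          norm_num
        rw [Finset.sum_const, hcard] at hlt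
        norm_num [degWeight] at hlt ⊢
        linarith
      · right
        push Not at h3
        refine ⟨by norm_num [degWeight] at hsum ⊢; linarith, ?_⟩
        refine Finset.sum_eq_zero fun x hx => degIn_eq_zero.2 fun y hy hxy => ?_
        rcases Finset.mem_insert.1 hx with rfl | hx
        · have := hadj y (by grind) hxy
          grind
        · have := hB.not_adj_of_degIn_eq_two
            (hadj x (Finset.mem_filter.1 hx).1 (Finset.mem_filter.1 hx).2) (h3 x hx) y
            (by grind) hxy
          grind
    · push Not at h2
      obtain ⟨v, hv, hadj⟩ := hB.exists_forall_adj_mem fun v hv => hmin v (hBS hv)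
      refine ⟨v, hv, hadj, Or.inl ?_⟩
      have hle : ∀ u ∈ insert v {u ∈ S | G.Adj v u}, degWeight (G.degIn S u) ≤ 2 := by
        intro u hu
        have huB : u ∈ B := by
          rcases Finset.mem_insert.1 hu with rfl | h
          · exact hv
          · exact hadj u (Finset.mem_filter.1 h).1 (Finset.mem_filter.1 h).2
        have h4 := h2 u huB
        have h5 := hmin u (hBS huB)
        rw [degWeight_of_three_le (by omega)]
      have hsum := Finset.sum_le_card_nsmul _ _ _ hle
      have hcard : #(insert v {u ∈ S | G.Adj v u}) ≤ 4 := by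
        have := hG S v
        have := Finset.card_insert_le v {u ∈ S | G.Adj v u}
        unfold degIn at *
        omega
      have : (#(insert v {u ∈ S | G.Adj v u}) : ℤ) ≤ 4 := by exact_mod_cast hcard
      rw [nsmul_eq_mul] at hsum
      linarith
  obtain ⟨M, hM⟩ : ∃ M, M = insert v {u ∈ S | G.Adj v u} := ⟨_, rfl⟩
  rw [← hM] at hsum
  have hvM : v ∈ M := by grind
  have hMB : M ⊆ B := by
    intro u hu
    grind
  have hMS : M ⊆ S := hMB.trans hBS
  refine exists_indep_of_removal (hBS hvB) hM (fun r => if r ∈ B then 0 else (G.degIn M r : ℤ))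
    ?_ ?_ ih
  · have h1 : ∑ r ∈ S \ M, (if r ∈ B then (0 : ℤ) else (G.degIn M r : ℤ)) =
        G.edgesBetween M (S \ B) := by
      rw [edgesBetween_comm, edgesBetween]
      push_cast
      rw [← Finset.sum_subset (Finset.sdiff_subset_sdiff (Finset.Subset.refl S) hMB)]
      · refine Finset.sum_congr rfl fun x hx => ?_
        rw [if_neg (Finset.mem_sdiff.1 hx).2]
      · intro x hx hx'
        rw [if_pos (by grind)]
    rw [h1]
    have h2 : (G.edgesBetween M (S \ B) : ℤ) ≤ 1 := by
      exact_mod_cast (edgesBetween_mono hMB (Finset.Subset.refl _)).trans hB.edges_le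
    rcases hsum with h | ⟨h, h0⟩
    · linarith
    · rw [h0]
      simpa using h
  · intro C hC hCne hCc hcl
    have hdeg : ∀ x ∈ C, G.degIn S x = G.degIn C x + G.degIn M x := fun x hx =>
      degIn_component hMS hC hcl hx
    have hgain : ∀ x ∈ C, degWeight (G.degIn S x) + G.degIn M x ≤ degWeight (G.degIn C x) := by
      intro x hx
      have h1 := hdeg x hx
      have h2 := degWeight_add_le (by omega : G.degIn C x ≤ G.degIn S x) (hG S x)
      rw [h1] at h2 ⊢
      push_cast at h2
      linarith
    have hnonneg : ∀ x ∈ C, (0 : ℤ) ≤ if x ∈ B then 0 else (G.degIn M x : ℤ) := by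
      intro x _
      split_ifs <;> positivity
    split_ifs with hC2
    · have h1 : ∑ x ∈ C, (degWeight (G.degIn S x) + 2) ≤ ∑ x ∈ C, degWeight (G.degIn C x) := by
        refine Finset.sum_le_sum fun x hx => ?_
        rw [hCc.degIn_eq_one hC2 hx]
        have := degWeight_le_of_two_le (hmin x (Finset.mem_sdiff.1 (hC hx)).1)
        have h5 : degWeight 1 = 5 := rfl
        linarith
      rw [Finset.sum_add_distrib, Finset.sum_const, hC2] at h1
      have h2 := Finset.sum_nonneg hnonneg
      norm_num at h1
      linarith
    · have h1 := Finset.sum_le_sum hgain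
      rw [Finset.sum_add_distrib, ← Nat.cast_sum] at h1
      have h2 := Finset.sum_nonneg hnonneg
      obtain ⟨x₀, hx₀, y, hy, hxy⟩ :=
        exists_edge_of_component hS ⟨v, hvM⟩ hMS hC hCne hcl
      have h3 : 0 < G.edgesBetween C M := edgesBetween_pos hx₀ hy hxy
      change _ + ((G.edgesBetween C M : ℕ) : ℤ) ≤ _ at h1
      by_cases h4 : 2 ≤ G.edgesBetween C M
      · have : (2 : ℤ) ≤ G.edgesBetween C M := by exact_mod_cast h4
        linarith
      · have h5 : G.edgesBetween C (S \ C) = G.edgesBetween C M := by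
          refine Finset.sum_congr rfl fun x hx => ?_
          have h6 := hdeg x hx
          have h7 := degIn_sdiff_add (G := G) (hC.trans Finset.sdiff_subset) x
          omega
        have hdis := hB.disjoint_of_edges_le (hC.trans Finset.sdiff_subset) hCc (by omega) hvB
          (fun h => by
            have := hC h
            grind)
        have h6 : ∑ x ∈ C, (if x ∈ B then (0 : ℤ) else (G.degIn M x : ℤ)) =
            G.edgesBetween C M := by
          rw [edgesBetween]
          push_cast
          refine Finset.sum_congr rfl fun x hx => ?_
          rw [if_neg (Finset.disjoint_left.1 hdis hx)]
        have h7 : (1 : ℤ) ≤ G.edgesBetween C M := by exact_mod_cast h3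
        rw [h6]
        linarith

/-- The weighted lower bound for the independence number of connected subcubic graphs. -/
theorem ConnOn.exists_indep (hG : ∀ (S : Finset V) (v : V), G.degIn S v ≤ 3)
    {S : Finset V} (hS : G.ConnOn S) (hne : S.Nonempty) :
    ∃ I ⊆ S, G.IsIndepSet (I : Set V) ∧
      ∑ u ∈ S, degWeight (G.degIn S u) ≤ 7 * #I + 2 + (if #S = 2 then 1 else 0) := by
  induction S using Finset.strongInduction with
  | H S ih =>
    obtain ⟨v, hv⟩ := hne
    by_cases hcard : 3 ≤ #S
    · have ih' : ∀ C ⊂ S, C.Nonempty → G.ConnOn C → ∃ I ⊆ C, G.IsIndepSet (I : Set V) ∧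
          ∑ u ∈ C, degWeight (G.degIn C u) ≤ 7 * #I + 2 + (if #C = 2 then 1 else 0) :=
        fun C hC hCne hCc => ih C hC hCc hCne
      simp only [if_neg (by omega : ¬ #S = 2), add_zero]
      by_cases hleaf : ∃ v ∈ S, G.degIn S v = 1
      · obtain ⟨v, hv, hdeg⟩ := hleaf
        exact exists_indep_of_leaf hG hS hcard hv hdeg ih'
      · push Not at hleaf
        refine exists_indep_of_two_le_degIn hG hS ⟨v, hv⟩ (fun v hv => ?_) ih'
        have h1 := hleaf v hv
        have h2 := hS.degIn_pos (by omega) hv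
        omega
    · refine ⟨{v}, by simpa, by simp, ?_⟩
      have hpos : 0 < #S := Finset.card_pos.2 ⟨v, hv⟩
      by_cases h2 : #S = 2
      · rw [if_pos h2, Finset.sum_congr rfl (fun x hx => by rw [hS.degIn_eq_one h2 hx]),
          Finset.sum_const, h2]
        norm_num [degWeight]
      · rw [if_neg h2]
        obtain ⟨w, rfl⟩ := Finset.card_eq_one.1 (by omega : #S = 1)
        rw [Finset.sum_singleton]
        have h3 : G.degIn {w} w = 0 := degIn_eq_zero.2 (by simp)
        rw [h3]
        norm_num [degWeight]

end MinDegreeTwo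

section ThreeColoring

variable {V : Type*} [DecidableEq V] {G : SimpleGraph V} [DecidableRel G.Adj]

/-- `c` is a proper coloring of the subgraph induced by `S`. -/
def ProperOn {K : Type*} (G : SimpleGraph V) (S : Finset V) (c : V → K) : Prop :=
  ∀ x ∈ S, ∀ y ∈ S, G.Adj x y → c x ≠ c y

theorem ProperOn.update {K : Type*} {S : Finset V} {c : V → K} (hc : G.ProperOn S c)
    {v : V} {k : K} (hk : ∀ u ∈ S, G.Adj v u → c u ≠ k) :
    G.ProperOn (insert v S) (Function.update c v k) := by
  intro x hx y hy hxy
  by_cases hxv : x = v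
  · subst hxv
    have hyx : y ≠ x := hxy.ne'
    have := hk y (by grind) hxy
    simpa [Function.update_of_ne hyx] using this.symm
  · by_cases hyv : y = v
    · subst hyv
      have := hk x (by grind) hxy.symm
      simpa [Function.update_of_ne hxv] using this
    · rw [Function.update_of_ne hxv, Function.update_of_ne hyv]
      exact hc x (by grind) y (by grind) hxy

theorem ProperOn.exists_insert {S : Finset V} {c : V → Fin 3} (hc : G.ProperOn S c) {v : V}
    (hv : v ∉ S) (h : #({u ∈ S | G.Adj v u}.image c) ≤ 2) :
    ∃ c' : V → Fin 3, G.ProperOn (insert v S) c' ∧ ∀ x ∈ S, c' x = c x := by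
  obtain ⟨k, hk⟩ : ∃ k, k ∉ {u ∈ S | G.Adj v u}.image c := by
    by_contra! hcon
    rw [Finset.eq_univ_iff_forall.2 hcon] at h
    simp at h
  refine ⟨Function.update c v k, hc.update fun u hu hvu huk => hk ?_, fun x hx => ?_⟩
  · exact Finset.mem_image.2 ⟨u, by simp [hu, hvu], huk⟩
  · rw [Function.update_of_ne]
    rintro rfl
    exact hv hx

/-- Greedy extension of a proper 3-coloring. -/
theorem ProperOn.exists_extend {D : Finset V} {c : V → Fin 3} (hc : G.ProperOn D c)
    (T : Finset V) (hDT : D ⊆ T)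
    (h : ∀ U ⊆ T \ D, U.Nonempty → ∃ u ∈ U, G.degIn (D ∪ U) u ≤ 2) :
    ∃ c' : V → Fin 3, G.ProperOn T c' ∧ ∀ x ∈ D, c' x = c x := by
  induction T using Finset.strongInduction with
  | H T ih =>
    rcases (T \ D).eq_empty_or_nonempty with hemp | hne
    · have : T = D := Finset.Subset.antisymm (Finset.sdiff_eq_empty_iff_subset.1 hemp) hDT
      exact ⟨c, this ▸ hc, fun _ _ => rfl⟩
    · obtain ⟨u, hu, hdeg⟩ := h _ (Finset.Subset.refl _) hne
      rw [Finset.union_sdiff_of_subset hDT] at hdeg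
      have huT : u ∈ T := (Finset.mem_sdiff.1 hu).1
      obtain ⟨c', hc', hag⟩ := ih (T.erase u) (Finset.erase_ssubset huT) (by grind)
        (fun U hU => h U (by grind))
      obtain ⟨c'', hc'', hag'⟩ := hc'.exists_insert (Finset.notMem_erase u T)
        (Finset.card_image_le.trans ((degIn_mono (Finset.erase_subset u T) u).trans hdeg))
      rw [Finset.insert_erase huT] at hc''
      exact ⟨c'', hc'', fun x hx => by rw [hag' x (by grind), hag x hx]⟩

theorem degIn_le_two_of_adj (hG : ∀ (S : Finset V) (v : V), G.degIn S v ≤ 3) {S : Finset V}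
    {u y : V} (hy : y ∉ S) (h : G.Adj u y) : G.degIn S u ≤ 2 := by
  have h1 := degIn_lt_of_adj (Finset.subset_insert y S) (Finset.mem_insert_self y S) hy h
  have h2 := hG (insert y S) u
  omega

/-- A proper subset of a connected set of a subcubic graph is 3-colorable. -/
theorem ConnOn.exists_properOn_of_ssubset (hG : ∀ (S : Finset V) (v : V), G.degIn S v ≤ 3)
    {S T : Finset V} (hS : G.ConnOn S) (hT : T ⊂ S) : ∃ c : V → Fin 3, G.ProperOn T c := by
  obtain ⟨c, hc, -⟩ := ProperOn.exists_extend (G := G) (D := ∅) (c := fun _ => (0 : Fin 3))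
    (by simp [ProperOn]) T (Finset.empty_subset T) (by
      intro U hU hne
      have hUT : U ⊆ T := hU.trans Finset.sdiff_subset
      obtain ⟨a, ha, b, hb, hbU, hab⟩ := hS U (hUT.trans hT.subset) hne
        (fun h => hT.not_subset (h ▸ hUT))
      exact ⟨a, ha, degIn_le_two_of_adj hG (by simpa using hbU) hab⟩)
  exact ⟨c, hc⟩

theorem ConnOn.adj_of_erase_not_connOn {Q : Finset V} {a b c d₀ : V} (ha : a ∈ Q) (hb : b ∈ Q)
    (hc : c ∈ Q) (hac : a ≠ c) (hbc : b ≠ c) (hd₀ : d₀ ∈ Q)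
    (hd₀abc : d₀ ≠ a ∧ d₀ ≠ b ∧ d₀ ≠ c) (hda : G.degIn Q a = 2) (hdb : G.degIn Q b = 2)
    (hmin : ∀ d ∈ Q, d ≠ a → d ≠ b → d ≠ c → ¬ G.ConnOn (Q.erase d))
    (hQ : G.ConnOn ((Q.erase a).erase b)) : G.Adj a b ∧ ¬ G.Adj a c := by
  have hcard : 2 ≤ #((Q.erase a).erase b) := by
    have : #({c, d₀} : Finset V) ≤ #((Q.erase a).erase b) :=
      Finset.card_le_card (by grind)
    rwa [Finset.card_pair (by grind)] at this
  obtain ⟨d, hd, hdc, hconn⟩ := hQ.exists_erase (x := c) (by grind) hcard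
  have hnone : ∀ y ∈ ((Q.erase a).erase b).erase d, ¬ G.Adj a y := by
    intro y hy hay
    have h1 : G.ConnOn (insert a (((Q.erase a).erase b).erase d)) := hconn.insert_adj hy hay.symm
    obtain ⟨z, hz, hbz, hzd⟩ : ∃ z ∈ Q, G.Adj b z ∧ z ≠ d := by
      by_contra! hcon
      have : #{z ∈ Q | G.Adj b z} ≤ #({d} : Finset V) := Finset.card_le_card (by grind)
      unfold degIn at hdb
      simp at this
      omega
    have hzb : z ≠ b := hbz.ne'
    have h2 := h1.insert_adj (x := z) (y := b) (by grind) hbz.symm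
    have h3 : insert b (insert a (((Q.erase a).erase b).erase d)) = Q.erase d := by grind
    rw [h3] at h2
    exact hmin d (by grind) (by grind) (by grind) hdc h2
  have hsub : {y ∈ Q | G.Adj a y} ⊆ {b, d} := by
    intro y hy
    rw [Finset.mem_filter] at hy
    have hya : y ≠ a := hy.2.ne'
    by_contra h
    exact hnone y (by grind) hy.2
  have heq : {y ∈ Q | G.Adj a y} = {b, d} :=
    Finset.eq_of_subset_of_card_le hsub (by
      unfold degIn at hda
      rw [hda]
      exact Finset.card_le_two)
  constructor
  · have : b ∈ {y ∈ Q | G.Adj a y} := by rw [heq]; simp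
    exact (Finset.mem_filter.1 this).2
  · intro h
    have : c ∈ ({b, d} : Finset V) := by rw [← heq]; simp [hc, h]
    grind

theorem ConnOn.exists_adj_notMem
    {S : Finset V} (hS : G.ConnOn S) (hcubic : ∀ v ∈ S, G.degIn S v = 3) (hcard : #S ≠ 4)
    {w : V} (hw : w ∈ S) {Q : Finset V} (hQS : Q ⊆ S.erase w) (hQ : G.ConnOn Q)
    (hN : {u ∈ S | G.Adj w u} ⊆ Q)
    (hmin : ∀ d ∈ Q, ¬ G.Adj w d → ¬ G.ConnOn (Q.erase d)) :
    ∃ u ∈ S, G.Adj w u ∧ ∃ u' ∈ S, u' ∉ insert w Q ∧ G.Adj u u' := by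
  by_contra! hcon
  have hNcard : #{u ∈ S | G.Adj w u} = 3 := hcubic w hw
  have hwQ : w ∉ Q := fun h => by simpa using hQS h
  have hdeg : ∀ u ∈ S, G.Adj w u → G.degIn Q u = 2 := by
    intro u hu hwu
    have h1 := hcubic u hu
    have h2 : {y ∈ S | G.Adj u y} = insert w {y ∈ Q | G.Adj u y} := by
      ext y
      have h3 := hcon u hu hwu y
      have h4 := hwu.symm
      have h5 : y ∈ Q → y ∈ S := fun h => Finset.mem_of_mem_erase (hQS h)
      simp only [Finset.mem_filter, Finset.mem_insert] at h3 ⊢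
      grind
    rw [degIn, h2, Finset.card_insert_of_notMem (by grind)] at h1
    unfold degIn
    omega
  by_cases hQN : Q ⊆ {u ∈ S | G.Adj w u}
  · have hQeq := Finset.Subset.antisymm hQN hN
    have hins : insert w Q = S := by
      by_contra hne
      obtain ⟨a, ha, b, hb, hbQ, hab⟩ := hS (insert w Q) (by grind) ⟨w, by simp⟩ hne
      rcases Finset.mem_insert.1 ha with rfl | ha
      · exact hbQ (Finset.mem_insert_of_mem (hN (by simp [hb, hab])))
      · have := hQN ha
        rw [Finset.mem_filter] at this
        exact hcon a this.1 this.2 b hb hbQ hab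
    rw [← hins, Finset.card_insert_of_notMem hwQ, hQeq, hNcard] at hcard
    omega
  · obtain ⟨d₀, hd₀, hd₀N⟩ := Finset.not_subset.1 hQN
    have hSd₀ : d₀ ∈ S := Finset.mem_of_mem_erase (hQS hd₀)
    have hQcard : 3 ≤ #Q := hNcard ▸ Finset.card_le_card hN
    obtain ⟨a, haQ, -, haconn⟩ := hQ.exists_erase hd₀ (by omega)
    have hadj : G.Adj w a := by
      by_contra h
      exact hmin a haQ h haconn
    have haS : a ∈ S := Finset.mem_of_mem_erase (hQS haQ)
    have hcard2 : #({u ∈ S | G.Adj w u}.erase a) = 2 := by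
      rw [Finset.card_erase_of_mem (by simp [haS, hadj]), hNcard]
    obtain ⟨b, c, hbc, hbceq⟩ := Finset.card_eq_two.1 hcard2
    have hb : b ∈ S ∧ G.Adj w b ∧ b ≠ a := by
      have : b ∈ {u ∈ S | G.Adj w u}.erase a := by rw [hbceq]; simp
      grind
    have hc : c ∈ S ∧ G.Adj w c ∧ c ≠ a := by
      have : c ∈ {u ∈ S | G.Adj w u}.erase a := by rw [hbceq]; simp
      grind
    have honly : ∀ y ∈ S, G.Adj w y → y ≠ a → y = b ∨ y = c := by
      intro y hy hwy hya
      have : y ∈ ({b, c} : Finset V) := by rw [← hbceq]; simp [hy, hwy, hya]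
      simpa using this
    have hbQ : b ∈ Q := hN (by simp [hb])
    have hcQ : c ∈ Q := hN (by simp [hc])
    have hda := hdeg a haS hadj
    have hmin' : ∀ d ∈ Q, d ≠ a → d ≠ b → d ≠ c → ¬ G.ConnOn (Q.erase d) := by
      intro d hd hda hdb hdc
      refine hmin d hd fun hwd => ?_
      have := honly d (Finset.mem_of_mem_erase (hQS hd)) hwd hda
      grind
    have hmin2 : ∀ d ∈ Q, d ≠ a → d ≠ b → d ≠ c → ¬ G.ConnOn ((Q.erase a).erase d) := by
      intro d hd hda' hdb hdc hconn
      obtain ⟨z, hz, haz, hzd⟩ : ∃ z ∈ Q, G.Adj a z ∧ z ≠ d := by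
        by_contra! hcon
        have : #{z ∈ Q | G.Adj a z} ≤ #({d} : Finset V) := Finset.card_le_card (by grind)
        unfold degIn at hda
        simp at this
        omega
      have hza : z ≠ a := haz.ne'
      have h2 := hconn.insert_adj (x := z) (y := a) (by grind) haz.symm
      have h3 : insert a ((Q.erase a).erase d) = Q.erase d := by grind
      rw [h3] at h2
      exact hmin' d hd hda' hdb hdc h2
    have hcard3 : 2 ≤ #(Q.erase a) := by
      rw [Finset.card_erase_of_mem haQ]
      omega
    have hd₀' : d₀ ≠ a ∧ d₀ ≠ b ∧ d₀ ≠ c := by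
      refine ⟨?_, ?_, ?_⟩ <;> rintro rfl <;> simp_all
    have hcc : G.ConnOn ((Q.erase a).erase c) := by
      obtain ⟨y, hy, hyb, hconn⟩ := haconn.exists_erase (x := b) (by grind) hcard3
      by_cases hyc : y = c
      · exact hyc ▸ hconn
      · exact absurd hconn (hmin2 y (by grind) (by grind) hyb hyc)
    have hbb : G.ConnOn ((Q.erase a).erase b) := by
      obtain ⟨y, hy, hyc, hconn⟩ := haconn.exists_erase (x := c) (by grind) hcard3
      by_cases hyb : y = b
      · exact hyb ▸ hconn
      · exact absurd hconn (hmin2 y (by grind) (by grind) hyb hyc)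
    have h1 := ConnOn.adj_of_erase_not_connOn haQ hbQ hcQ hc.2.2.symm hbc hd₀ hd₀'
      hda (hdeg b hb.1 hb.2.1) hmin' hbb
    have h2 := ConnOn.adj_of_erase_not_connOn haQ hcQ hbQ hb.2.2.symm hbc.symm hd₀
      ⟨hd₀'.1, hd₀'.2.2, hd₀'.2.1⟩ hda (hdeg c hc.1 hc.2.1)
      (fun d hd h1 h2 h3 => hmin' d hd h1 h3 h2) hcc
    exact h1.2 h2.1

/-- Brooks' theorem for connected cubic graphs. -/
theorem ConnOn.exists_properOn_of_cubic (hG : ∀ (S : Finset V) (v : V), G.degIn S v ≤ 3)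
    {S : Finset V} (hS : G.ConnOn S) (hne : S.Nonempty) (hcubic : ∀ v ∈ S, G.degIn S v = 3)
    (hcard : #S ≠ 4) : ∃ c : V → Fin 3, G.ProperOn S c := by
  obtain ⟨r, hr⟩ := hne
  obtain ⟨w, hw, -, hconn⟩ := hS.exists_erase hr (by
    have := degIn_lt_card (G := G) hr
    have := hcubic r hr
    omega)
  classical
  obtain ⟨Q, hQ, hQmin⟩ := Finset.exists_min_image
    ((S.erase w).powerset.filter fun Q => {u ∈ S | G.Adj w u} ⊆ Q ∧ G.ConnOn Q) Finset.card
    ⟨S.erase w, by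
      simp only [Finset.mem_filter, Finset.mem_powerset]
      refine ⟨Finset.Subset.refl _, fun u hu => ?_, hconn⟩
      rw [Finset.mem_filter] at hu
      exact Finset.mem_erase.2 ⟨hu.2.ne', hu.1⟩⟩
  simp only [Finset.mem_filter, Finset.mem_powerset] at hQ hQmin
  obtain ⟨hQS, hNQ, hQc⟩ := hQ
  have hwQ : w ∉ Q := fun h => by simpa using hQS h
  have hQS' : Q ⊆ S := hQS.trans (Finset.erase_subset _ _)
  obtain ⟨u, hu, hwu, u', hu', hu'Q, huu'⟩ := hS.exists_adj_notMem hcubic hcard hw hQS hQc hNQ (by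
    intro d hd hwd hcd
    have := hQmin (Q.erase d) ⟨(Finset.erase_subset _ _).trans hQS, fun y hy => by
      have := hNQ hy
      grind, hcd⟩
    have := Finset.card_erase_lt_of_mem hd
    omega)
  have huQ : u ∈ Q := hNQ (by simp [hu, hwu])
  obtain ⟨c₀, hc₀⟩ := hS.exists_properOn_of_ssubset hG (T := S \ insert w Q)
    ⟨Finset.sdiff_subset, fun h => by
      have := h hw
      simp at this⟩
  have hc₁ : G.ProperOn (insert w (S \ insert w Q)) (Function.update c₀ w (c₀ u')) :=
    hc₀.update fun y hy hwy => by
      have : y ∈ Q := hNQ (by simp [hwy, (Finset.mem_sdiff.1 hy).1])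
      grind
  obtain ⟨c₂, hc₂, hag⟩ := hc₁.exists_extend (S.erase u) (by
    intro y hy
    have := hwu.ne
    grind) (by
    intro U hU hUne
    have hUQ : U ⊆ Q := by
      intro y hy
      have := hU hy
      grind
    obtain ⟨a, ha, b, hb, hbU, hab⟩ := hQc U hUQ hUne (by
      rintro rfl
      have := hU huQ
      grind)
    exact ⟨a, ha, degIn_le_two_of_adj hG (y := b) (by grind) hab⟩)
  have hsame : c₂ w = c₂ u' := by
    have hu'w : u' ≠ w := by grind
    rw [hag w (by simp), hag u' (by grind), Function.update_self, Function.update_of_ne hu'w]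
  obtain ⟨c₃, hc₃, -⟩ := hc₂.exists_insert (Finset.notMem_erase u S) (by
    have hsub : {y ∈ S.erase u | G.Adj u y}.image c₂ ⊆
        ({y ∈ S.erase u | G.Adj u y}.erase w).image c₂ := by
      intro k hk
      obtain ⟨y, hy, rfl⟩ := Finset.mem_image.1 hk
      have hu'u : u' ≠ u := huu'.ne'
      by_cases hyw : y = w
      · subst hyw
        exact Finset.mem_image.2 ⟨u', by grind, hsame.symm⟩
      · exact Finset.mem_image.2 ⟨y, by grind, rfl⟩
    refine (Finset.card_le_card hsub).trans (Finset.card_image_le.trans ?_)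
    rw [Finset.card_erase_of_mem (by
      have := hwu.symm
      have := hwu.ne
      grind)]
    have := hG (S.erase u) u
    unfold degIn at this
    omega)
  rw [Finset.insert_erase hu] at hc₃
  exact ⟨c₃, hc₃⟩

theorem ConnOn.exists_properOn (hG : ∀ (S : Finset V) (v : V), G.degIn S v ≤ 3)
    {S : Finset V} (hS : G.ConnOn S) (hne : S.Nonempty)
    (hK4 : (∀ v ∈ S, G.degIn S v = 3) → #S ≠ 4) : ∃ c : V → Fin 3, G.ProperOn S c := by
  by_cases hcubic : ∀ v ∈ S, G.degIn S v = 3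
  · exact hS.exists_properOn_of_cubic hG hne hcubic (hK4 hcubic)
  · push Not at hcubic
    obtain ⟨v, hv, hdeg⟩ := hcubic
    obtain ⟨c, hc⟩ := hS.exists_properOn_of_ssubset hG (Finset.erase_ssubset hv)
    obtain ⟨c', hc', -⟩ := hc.exists_insert (Finset.notMem_erase v S)
      (Finset.card_image_le.trans (by
        have h1 := hG S v
        have h2 := degIn_mono (G := G) (Finset.erase_subset v S) v
        unfold degIn at *
        omega))
    rw [Finset.insert_erase hv] at hc'
    exact ⟨c', hc'⟩

theorem ProperOn.exists_indep {S : Finset V} {c : V → Fin 3} (hc : G.ProperOn S c) :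
    ∃ I ⊆ S, G.IsIndepSet (I : Set V) ∧ #S ≤ 3 * #I := by
  obtain ⟨k, -, hk⟩ := Finset.exists_max_image (univ : Finset (Fin 3))
    (fun k => #{x ∈ S | c x = k}) ⟨0, Finset.mem_univ 0⟩
  refine ⟨{x ∈ S | c x = k}, Finset.filter_subset _ _, ?_, ?_⟩
  · intro x hx y hy _ hxy
    simp only [Finset.coe_filter, Set.mem_ofPred_eq] at hx hy
    exact hc x hx.1 y hy.1 hxy (hx.2.trans hy.2.symm)
  · rw [Finset.card_eq_sum_card_fiberwise (f := c) (t := univ) (fun _ _ => by simp)]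
    simpa using Finset.sum_le_card_nsmul univ _ _ hk

/-- Take all leaves and a third of the vertices outside their closed neighbourhoods. -/
theorem ConnOn.exists_indep_card_add_leaves
    (hG : ∀ (S : Finset V) (v : V), G.degIn S v ≤ 3)
    {S : Finset V} (hS : G.ConnOn S) (hcard : 3 ≤ #S)
    (hK4 : (∀ v ∈ S, G.degIn S v = 3) → #S ≠ 4) :
    ∃ I ⊆ S, G.IsIndepSet (I : Set V) ∧ #S + #{v ∈ S | G.degIn S v = 1} ≤ 3 * #I := by
  obtain ⟨L, hL⟩ : ∃ L, L = {v ∈ S | G.degIn S v = 1} := ⟨_, rfl⟩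
  obtain ⟨M, hM⟩ : ∃ M, M = L.biUnion fun v => {u ∈ S | G.Adj v u} := ⟨_, rfl⟩
  rw [← hL]
  have hMcard : #M ≤ #L := by
    rw [hM]
    have := Finset.card_biUnion_le_card_mul L (fun v => {u ∈ S | G.Adj v u}) 1 (by
      intro v hv
      rw [hL, Finset.mem_filter] at hv
      exact hv.2.le)
    simpa using this
  have hLS : L ⊆ S := by rw [hL]; exact Finset.filter_subset _ _
  have hLind : ∀ x ∈ L, ∀ y ∈ L, ¬ G.Adj x y := by
    intro x hx y hy hxy
    have key : ∀ x ∈ L, ∀ y ∈ L, G.Adj x y → ∀ z ∈ S, G.Adj x z → z = y := by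
      intro x hx y hy hxy z hz hxz
      rw [hL, Finset.mem_filter] at hx
      obtain ⟨t, ht⟩ := Finset.card_eq_one.1 hx.2
      have h1 : y ∈ ({t} : Finset V) := by rw [← ht]; simp [hLS hy, hxy]
      have h2 : z ∈ ({t} : Finset V) := by rw [← ht]; simp [hz, hxz]
      simp only [Finset.mem_singleton] at h1 h2
      rw [h1, h2]
    obtain ⟨a, ha, b, hb, hbn, hab⟩ := hS {x, y} (by
      have := hLS hx
      have := hLS hy
      grind) ⟨x, by simp⟩ (by
      rintro rfl
      have := Finset.card_le_two (a := x) (b := y)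
      omega)
    simp only [Finset.mem_insert, Finset.mem_singleton] at ha hbn
    rcases ha with rfl | rfl
    · have := key a hx y hy hxy b hb hab
      grind
    · have := key a hy x hx hxy.symm b hb hab
      grind
  obtain ⟨c, hc⟩ : ∃ c : V → Fin 3, G.ProperOn (S \ (L ∪ M)) c := by
    obtain ⟨r, hr⟩ := Finset.card_pos.1 (by omega : 0 < #S)
    rcases (L ∪ M).eq_empty_or_nonempty with h | ⟨x, hx⟩
    · rw [h, Finset.sdiff_empty]
      exact hS.exists_properOn hG ⟨r, hr⟩ hK4
    · refine hS.exists_properOn_of_ssubset hG ⟨Finset.sdiff_subset, fun h => ?_⟩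
      have hxS : x ∈ S := by
        rcases Finset.mem_union.1 hx with h | h
        · exact hLS h
        · rw [hM, Finset.mem_biUnion] at h
          obtain ⟨v, -, hv⟩ := h
          exact (Finset.mem_filter.1 hv).1
      have := h hxS
      grind
  obtain ⟨J, hJS, hJ, hJcard⟩ := hc.exists_indep
  have hcross : ∀ x ∈ L, ∀ y ∈ J, ¬ G.Adj x y := by
    intro x hx y hy hxy
    have h1 := Finset.mem_sdiff.1 (hJS hy)
    refine h1.2 (Finset.mem_union_right _ ?_)
    rw [hM, Finset.mem_biUnion]
    exact ⟨x, hx, by simp [h1.1, hxy]⟩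
  refine ⟨L ∪ J, by grind, ?_, ?_⟩
  · intro x hx y hy hxy hadj
    simp only [Finset.coe_union, Set.mem_union, Finset.mem_coe] at hx hy
    rcases hx with hx | hx <;> rcases hy with hy | hy
    · exact hLind x hx y hy hadj
    · exact hcross x hx y hy hadj
    · exact hcross y hy x hx hadj.symm
    · exact hJ hx hy hxy hadj
  · rw [Finset.card_union_of_disjoint (by
      rw [Finset.disjoint_left]
      intro x hx hx'
      have := hJS hx'
      grind)]
    have h1 := Finset.le_card_sdiff (L ∪ M) S
    have h2 := Finset.card_union_le L M
    omega

end ThreeColoring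

section ClassGBounds

variable {V : Type*} {G : SimpleGraph V}

theorem degIn_univ [Fintype V] (G : SimpleGraph V) [DecidableRel G.Adj]
    (v : V) : G.degIn univ v = (G.neighborSet v).ncard := by
  rw [Set.ncard_eq_toFinset_card', Set.toFinset_card, card_neighborSet_eq_degree, degIn,
    ← card_neighborFinset_eq_degree, neighborFinset_eq_filter]

theorem ncard_degreeClass [Fintype V] (G : SimpleGraph V) [DecidableRel G.Adj]
    (i : ℕ) : (degreeClass G i).ncard = #{v | G.degIn univ v = i} := by
  rw [← Set.ncard_coe_finset]
  congr 1
  ext v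
  simp [degreeClass, degIn_univ]

theorem card_ne_four_of_classG [Fintype V] [DecidableEq V] [DecidableRel G.Adj]
    (hG : ClassG G) (hcubic : ∀ v, G.degIn univ v = 3) : #(univ : Finset V) ≠ 4 := by
  intro hcard
  have htop : G = ⊤ := by
    ext x y
    refine ⟨fun h => h.ne, fun hxy => ?_⟩
    have h1 : ({u | G.Adj x u} : Finset V) = univ.erase x := by
      refine Finset.eq_of_subset_of_card_le (fun u hu => ?_) ?_
      · have := (Finset.mem_filter.1 hu).2.ne'
        simpa
      · rw [Finset.card_erase_of_mem (Finset.mem_univ x), hcard]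
        exact (hcubic x).ge
    have h2 : y ∈ ({u | G.Adj x u} : Finset V) := by
      rw [h1]
      simpa using Ne.symm hxy
    simpa using h2
  subst htop
  exact hG.ne_K4.false (Iso.completeGraph (Fintype.equivFinOfCardEq hcard))

/-- The degree classes partition the vertices of a member of `𝒢`. -/
theorem sum_eq_degree_counts [Fintype V] [DecidableEq V] [DecidableRel G.Adj]
    (h : ∀ v, 1 ≤ G.degIn univ v ∧ G.degIn univ v ≤ 3) (f : ℕ → ℤ) :
    ∑ v, f (G.degIn univ v) = f 1 * (degreeClass G 1).ncard + f 2 * (degreeClass G 2).ncard +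
      f 3 * (degreeClass G 3).ncard := by
  rw [← Finset.sum_fiberwise_of_maps_to (t := Finset.Icc 1 3) (g := fun v => G.degIn univ v)
    (fun v _ => Finset.mem_Icc.2 (h v))]
  have h1 : ∀ i ∈ Finset.Icc 1 3, ∑ v with G.degIn univ v = i, f (G.degIn univ v) =
      f i * (degreeClass G i).ncard := by
    intro i _
    rw [ncard_degreeClass, Finset.sum_congr rfl (g := fun _ => f i) (fun v hv => by
      rw [(Finset.mem_filter.1 hv).2]), Finset.sum_const, nsmul_eq_mul, mul_comm]
  rw [Finset.sum_congr rfl h1]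
  simp [Finset.sum_Icc_succ_top]

theorem indepNum_bounds_of_classG (hG : ClassG G) :
    2 * (degreeClass G 1).ncard + (degreeClass G 2).ncard + (degreeClass G 3).ncard ≤
        3 * G.indepNum ∧
    5 * (degreeClass G 1).ncard + 3 * (degreeClass G 2).ncard + 2 * (degreeClass G 3).ncard ≤
        7 * G.indepNum + 2 ∧
    (degreeClass G 1).ncard ≤ (degreeClass G 3).ncard + 2 := by
  classical
  have := hG.finite
  have := Fintype.ofFinite V
  have hcard : 3 ≤ #(univ : Finset V) := by
    have := hG.three_le_card
    rwa [Nat.card_eq_fintype_card] at this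
  have hconn := hG.connected.connOn_univ
  have hsub : ∀ (S : Finset V) (v : V), G.degIn S v ≤ 3 := fun S v =>
    (degIn_mono (Finset.subset_univ S) v).trans (degIn_univ G v ▸ hG.subcubic v)
  have hdeg : ∀ v, 1 ≤ G.degIn univ v ∧ G.degIn univ v ≤ 3 := fun v =>
    ⟨hconn.degIn_pos (by omega) (Finset.mem_univ v), hsub _ v⟩
  have hcount : (#(univ : Finset V) : ℤ) = (degreeClass G 1).ncard + (degreeClass G 2).ncard +
      (degreeClass G 3).ncard := by
    simpa using sum_eq_degree_counts hdeg (fun _ => 1)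
  refine ⟨?_, ?_, ?_⟩
  · obtain ⟨I, -, hI, hle⟩ := hconn.exists_indep_card_add_leaves hsub hcard
      (fun h => card_ne_four_of_classG hG fun v => h v (Finset.mem_univ v))
    have h1 := hI.card_le_indepNum
    rw [← ncard_degreeClass] at hle
    omega
  · obtain ⟨I, -, hI, hle⟩ := hconn.exists_indep hsub (Finset.card_pos.1 (by omega))
    have h1 := hI.card_le_indepNum
    rw [sum_eq_degree_counts hdeg degWeight, if_neg (by omega)] at hle
    norm_num [degWeight] at hle
    omega
  · have h1 := hG.connected.card_vert_le_card_edgeSet_add_one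
    have h2 := G.sum_degrees_eq_twice_card_edges
    have h3 := sum_eq_degree_counts hdeg (fun i => i)
    have h4 : ∀ v, G.degIn univ v = G.degree v := fun v => by
      rw [degIn, ← card_neighborFinset_eq_degree, neighborFinset_eq_filter]
    simp only [h4, ← Nat.cast_sum, h2] at h3
    rw [Nat.card_eq_fintype_card, Nat.card_eq_fintype_card, ← edgeFinset_card] at h1
    rw [Finset.card_univ] at hcount
    push_cast at h3
    omega

end ClassGBounds

section Isomorphisms

variable {V W : Type*} {G : SimpleGraph V} {H : SimpleGraph W}

theorem Iso.indepNum_le [Finite W] (e : G ≃g H) : G.indepNum ≤ H.indepNum := by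
  have : Finite V := Finite.of_equiv W e.symm.toEquiv
  have := Fintype.ofFinite V
  obtain ⟨s, hs⟩ := G.exists_isNIndepSet_indepNum
  have hind : H.IsIndepSet (s.map e.toEquiv.toEmbedding : Finset W) := by
    intro x hx y hy hxy hadj
    simp only [Finset.coe_map, Set.mem_image, Finset.mem_coe] at hx hy
    obtain ⟨x, hx, rfl⟩ := hx
    obtain ⟨y, hy, rfl⟩ := hy
    exact hs.isIndepSet hx hy (fun h => hxy (h ▸ rfl)) (e.map_adj_iff.1 hadj)
  simpa [hs.card_eq] using hind.card_le_indepNum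

theorem Iso.indepNum_eq [Finite W] (e : G ≃g H) : G.indepNum = H.indepNum :=
  have : Finite V := Finite.of_equiv W e.symm.toEquiv
  le_antisymm e.indepNum_le e.symm.indepNum_le

theorem Iso.ncard_neighborSet (e : G ≃g H) (v : V) :
    (H.neighborSet (e v)).ncard = (G.neighborSet v).ncard := by
  rw [← Set.ncard_image_of_injective (G.neighborSet v) e.injective]
  congr 1
  ext w
  constructor
  · intro h
    exact ⟨e.symm w, e.map_adj_iff.1 (by simpa using h), by simp⟩
  · rintro ⟨u, hu, rfl⟩
    exact e.map_adj_iff.2 hu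

theorem Iso.ncard_degreeClass (e : G ≃g H) (i : ℕ) :
    (degreeClass G i).ncard = (degreeClass H i).ncard := by
  rw [← Set.ncard_image_of_injective (degreeClass G i) e.injective]
  congr 1
  ext w
  constructor
  · rintro ⟨u, hu, rfl⟩
    exact (e.ncard_neighborSet u).trans hu
  · intro h
    refine ⟨e.symm w, ?_, by simp⟩
    have := e.ncard_neighborSet (e.symm w)
    rw [RelIso.apply_symm_apply] at this
    exact this.symm.trans h

end Isomorphisms

section AttachTriangle

variable {V : Type*} {G : SimpleGraph V} {x : V} {t : Fin 3}

theorem attachTriangle_adj_inl_inl {y z : V} :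
    (attachTriangle G x t).Adj (Sum.inl y) (Sum.inl z) ↔ G.Adj y z := by
  simp [attachTriangle, edge_adj]

theorem attachTriangle_adj_inr_inr {s r : Fin 3} :
    (attachTriangle G x t).Adj (Sum.inr s) (Sum.inr r) ↔ s ≠ r := by
  simp [attachTriangle, edge_adj]

theorem attachTriangle_adj_inl_inr {y : V} {s : Fin 3} :
    (attachTriangle G x t).Adj (Sum.inl y) (Sum.inr s) ↔ y = x ∧ s = t := by
  simp [attachTriangle, edge_adj]

theorem ncard_ne_fin_three (s : Fin 3) : {r : Fin 3 | s ≠ r}.ncard = 2 := by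
  rw [Set.ncard_eq_toFinset_card']
  revert s
  decide

theorem ncard_neighborSet_attachTriangle_inl {y : V} (hy : y ≠ x) :
    ((attachTriangle G x t).neighborSet (Sum.inl y)).ncard = (G.neighborSet y).ncard := by
  rw [← Set.ncard_image_of_injective (G.neighborSet y) (Sum.inl_injective (β := Fin 3))]
  congr 1
  ext (z | s)
  · simp [attachTriangle_adj_inl_inl]
  · simp [attachTriangle_adj_inl_inr, hy]

theorem ncard_neighborSet_attachTriangle_inl_self [Finite V] :
    ((attachTriangle G x t).neighborSet (Sum.inl x)).ncard = (G.neighborSet x).ncard + 1 := by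
  rw [← Set.ncard_image_of_injective (G.neighborSet x) (Sum.inl_injective (β := Fin 3)),
    ← Set.ncard_insert_of_notMem (a := Sum.inr t) (by simp) (Set.toFinite _)]
  congr 1
  ext (z | s)
  · simp [attachTriangle_adj_inl_inl]
  · simp [attachTriangle_adj_inl_inr]

theorem ncard_neighborSet_attachTriangle_inr {s : Fin 3} (hs : s ≠ t) :
    ((attachTriangle G x t).neighborSet (Sum.inr s)).ncard = 2 := by
  have h := ncard_ne_fin_three s
  rw [← Set.ncard_image_of_injective _ (Sum.inr_injective (α := V))] at h
  rw [← h]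
  congr 1
  ext (z | r)
  · simp [(attachTriangle G x t).adj_comm (Sum.inr s), attachTriangle_adj_inl_inr, hs]
  · simp [attachTriangle_adj_inr_inr]

theorem ncard_neighborSet_attachTriangle_inr_self :
    ((attachTriangle G x t).neighborSet (Sum.inr t)).ncard = 3 := by
  have h := ncard_ne_fin_three t
  rw [← Set.ncard_image_of_injective _ (Sum.inr_injective (α := V))] at h
  have h2 := Set.ncard_insert_of_notMem
    (s := (Sum.inr '' {r : Fin 3 | t ≠ r} : Set (V ⊕ Fin 3)))
    (a := Sum.inl x) (by simp) (Set.toFinite _)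
  rw [h] at h2
  refine Eq.trans ?_ h2
  congr 1
  ext (z | r)
  · simp [(attachTriangle G x t).adj_comm (Sum.inr t), attachTriangle_adj_inl_inr]
  · simp [attachTriangle_adj_inr_inr]

theorem indepNum_attachTriangle [Finite V] :
    (attachTriangle G x t).indepNum = G.indepNum + 1 := by
  have := Fintype.ofFinite V
  apply le_antisymm
  · obtain ⟨s, hs⟩ := (attachTriangle G x t).exists_isNIndepSet_indepNum
    rw [← hs.card_eq, ← Finset.card_toLeft_add_card_toRight]
    have hleft : G.IsIndepSet (s.toLeft : Set V) := by
      intro y hy z hz hyz hadj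
      simp only [Finset.mem_coe, Finset.mem_toLeft] at hy hz
      exact hs.isIndepSet hy hz (by simpa using hyz) (attachTriangle_adj_inl_inl.2 hadj)
    have hright : #s.toRight ≤ 1 := by
      rw [Finset.card_le_one]
      intro a ha b hb
      by_contra hab
      rw [Finset.mem_toRight] at ha hb
      exact hs.isIndepSet ha hb (by simpa using hab) (attachTriangle_adj_inr_inr.2 hab)
    exact Nat.add_le_add hleft.card_le_indepNum hright
  · obtain ⟨s, hs⟩ := G.exists_isNIndepSet_indepNum
    obtain ⟨r, hr⟩ : ∃ r : Fin 3, r ≠ t := exists_ne t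
    have hind : (attachTriangle G x t).IsIndepSet (s.disjSum {r} : Finset (V ⊕ Fin 3)) := by
      rintro (y | y) hy (z | z) hz hyz hadj
      · simp only [Finset.mem_coe, Finset.inl_mem_disjSum] at hy hz
        exact hs.isIndepSet hy hz (fun h => hyz (h ▸ rfl)) (attachTriangle_adj_inl_inl.1 hadj)
      · simp only [Finset.mem_coe, Finset.inr_mem_disjSum, Finset.mem_singleton] at hz
        exact hr (hz ▸ (attachTriangle_adj_inl_inr.1 hadj).2)
      · simp only [Finset.mem_coe, Finset.inr_mem_disjSum, Finset.mem_singleton] at hy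
        exact hr (hy ▸ (attachTriangle_adj_inl_inr.1 hadj.symm).2)
      · simp only [Finset.mem_coe, Finset.inr_mem_disjSum, Finset.mem_singleton] at hy hz
        exact hyz (hy ▸ hz ▸ rfl)
    have := hind.card_le_indepNum
    rwa [Finset.card_disjSum, hs.card_eq, Finset.card_singleton] at this

theorem degreeClass_attachTriangle_one [Finite V] (hx : x ∈ degreeClass G 2) :
    (degreeClass (attachTriangle G x t) 1).ncard = (degreeClass G 1).ncard := by
  rw [← Set.ncard_image_of_injective (degreeClass G 1) (Sum.inl_injective (β := Fin 3))]
  congr 1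
  have hx' : (G.neighborSet x).ncard = 2 := hx
  ext (y | s)
  · by_cases hy : y = x
    · subst hy
      simp [-Set.ncard_eq_one, degreeClass, ncard_neighborSet_attachTriangle_inl_self, hx']
    · simp [-Set.ncard_eq_one, degreeClass, ncard_neighborSet_attachTriangle_inl hy]
  · by_cases hs : s = t
    · subst hs
      simp [-Set.ncard_eq_one, degreeClass, ncard_neighborSet_attachTriangle_inr_self]
    · simp [-Set.ncard_eq_one, degreeClass, ncard_neighborSet_attachTriangle_inr hs]

theorem degreeClass_attachTriangle_two [Finite V] (hx : x ∈ degreeClass G 2) :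
    (degreeClass (attachTriangle G x t) 2).ncard = (degreeClass G 2).ncard + 1 := by
  have hx' : (G.neighborSet x).ncard = 2 := hx
  have h1 : degreeClass (attachTriangle G x t) 2 =
      (Sum.inl '' (degreeClass G 2 \ {x}) ∪ Sum.inr '' {s | t ≠ s}) := by
    ext (y | s)
    · by_cases hy : y = x
      · subst hy
        simp [degreeClass, ncard_neighborSet_attachTriangle_inl_self, hx']
      · simp [degreeClass, ncard_neighborSet_attachTriangle_inl hy, hy]
    · by_cases hs : s = t
      · subst hs
        simp [degreeClass, ncard_neighborSet_attachTriangle_inr_self]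
      · simp [degreeClass, ncard_neighborSet_attachTriangle_inr hs, Ne.symm hs]
  rw [h1, Set.ncard_union_eq (by
    rw [Set.disjoint_left]
    rintro _ ⟨y, -, rfl⟩ ⟨s, -, h⟩
    simp at h) (Set.toFinite _) (Set.toFinite _),
    Set.ncard_image_of_injective _ Sum.inl_injective,
    Set.ncard_image_of_injective _ Sum.inr_injective, ncard_ne_fin_three]
  have := Set.ncard_sdiff_singleton_add_one hx (Set.toFinite _)
  omega

theorem degreeClass_attachTriangle_three [Finite V] (hx : x ∈ degreeClass G 2) :
    (degreeClass (attachTriangle G x t) 3).ncard = (degreeClass G 3).ncard + 2 := by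
  have hx' : (G.neighborSet x).ncard = 2 := hx
  have h1 : degreeClass (attachTriangle G x t) 3 =
      (Sum.inl '' degreeClass G 3 ∪ {Sum.inl x, Sum.inr t}) := by
    ext (y | s)
    · by_cases hy : y = x
      · subst hy
        simp [degreeClass, ncard_neighborSet_attachTriangle_inl_self, hx']
      · simp [degreeClass, ncard_neighborSet_attachTriangle_inl hy, hy]
    · by_cases hs : s = t
      · subst hs
        simp [degreeClass, ncard_neighborSet_attachTriangle_inr_self]
      · simp [degreeClass, ncard_neighborSet_attachTriangle_inr hs, hs]
  rw [h1, Set.ncard_union_eq (by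
    rw [Set.disjoint_left]
    rintro _ ⟨y, hy, rfl⟩ h
    simp only [Set.mem_insert_iff, Sum.inl.injEq, Set.mem_singleton_iff, reduceCtorEq,
      or_false] at h
    subst h
    have hy' : (G.neighborSet y).ncard = 3 := hy
    omega) (Set.toFinite _) (Set.toFinite _),
    Set.ncard_image_of_injective _ Sum.inl_injective, Set.ncard_pair (by simp)]

end AttachTriangle

section ClassA

theorem indepNum_top_fin_three : (⊤ : SimpleGraph (Fin 3)).indepNum = 1 := by
  apply le_antisymm
  · obtain ⟨s, hs⟩ := (⊤ : SimpleGraph (Fin 3)).exists_isNIndepSet_indepNum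
    rw [← hs.card_eq, Finset.card_le_one]
    intro a ha b hb
    by_contra hab
    exact hs.isIndepSet ha hb hab hab
  · have : (⊤ : SimpleGraph (Fin 3)).IsIndepSet (({0} : Finset (Fin 3)) : Set (Fin 3)) := by
      simp
    simpa using this.card_le_indepNum

theorem degreeClass_top_fin_three (i : ℕ) :
    degreeClass (⊤ : SimpleGraph (Fin 3)) i = {_v | 2 = i} := by
  ext v
  have : (⊤ : SimpleGraph (Fin 3)).neighborSet v = {r | v ≠ r} := by
    ext r
    simp [eq_comm]
  simp only [degreeClass, Set.mem_ofPred_eq, this, ncard_ne_fin_three]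

theorem classA_counts {V : Type u} {G : SimpleGraph V} (h : ClassA G) :
    Finite V ∧ (degreeClass G 1).ncard = 0 ∧ (degreeClass G 2).ncard = G.indepNum + 2 ∧
      (degreeClass G 3).ncard + 2 = 2 * G.indepNum := by
  induction h with
  | triangle G e =>
    refine ⟨Finite.of_equiv _ e.symm.toEquiv, ?_⟩
    simp only [e.ncard_degreeClass, e.indepNum_eq, degreeClass_top_fin_three,
      indepNum_top_fin_three]
    simp
  | attach G' h x hx t G e ih =>
    obtain ⟨hfin, h1, h2, h3⟩ := ih
    refine ⟨Finite.of_equiv _ e.symm.toEquiv, ?_⟩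
    simp only [e.ncard_degreeClass, e.indepNum_eq, indepNum_attachTriangle,
      degreeClass_attachTriangle_one hx, degreeClass_attachTriangle_two hx,
      degreeClass_attachTriangle_three hx]
    omega

end ClassA

section PendantPath

theorem indepNum_pendantPath (n : ℕ) : (pendantPath n).indepNum = n := by
  apply le_antisymm
  · obtain ⟨s, hs⟩ := (pendantPath n).exists_isNIndepSet_indepNum
    rw [← hs.card_eq]
    have hinj : Set.InjOn (Sum.elim id id : Fin n ⊕ Fin n → Fin n) s := by
      rintro (i | i) hi (j | j) hj hij
      · exact congrArg Sum.inl hij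
      · exact absurd hij (hs.isIndepSet hi hj (by simp))
      · exact absurd hij (hs.isIndepSet hi hj (by simp))
      · exact congrArg Sum.inr hij
    simpa using Finset.card_le_card_of_injOn (t := univ) _ (fun _ _ => by simp) hinj
  · have : (pendantPath n).IsIndepSet
        ((univ : Finset (Fin n)).map ⟨Sum.inr, Sum.inr_injective⟩ : Finset (Fin n ⊕ Fin n)) := by
      rintro (i | i) hi (j | j) hj _ hadj
      · simp at hi
      · simp at hi
      · simp at hj
      · exact hadj
    simpa using this.card_le_indepNum

theorem ncard_neighborSet_pendantPath_inr {n : ℕ} (i : Fin n) :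
    ((pendantPath n).neighborSet (Sum.inr i)).ncard = 1 := by
  rw [Set.ncard_eq_one]
  refine ⟨Sum.inl i, ?_⟩
  ext (j | j)
  · exact ⟨fun h => congrArg Sum.inl (Eq.symm h), fun h => (Sum.inl_injective h).symm⟩
  · exact ⟨fun h => h.elim, fun h => by simp at h⟩

theorem ncard_neighborSet_pendantPath_inl {n : ℕ} (i : Fin n) :
    ((pendantPath n).neighborSet (Sum.inl i)).ncard =
      ((pathGraph n).neighborSet i).ncard + 1 := by
  rw [← Set.ncard_image_of_injective ((pathGraph n).neighborSet i)
      (Sum.inl_injective (β := Fin n)),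
    ← Set.ncard_insert_of_notMem (a := Sum.inr i) (by simp) (Set.toFinite _)]
  congr 1
  ext (j | j)
  · simp [pendantPath]
  · simp [pendantPath, eq_comm]

theorem ncard_neighborSet_pathGraph {m : ℕ} (i : Fin (m + 2)) :
    ((pathGraph (m + 2)).neighborSet i).ncard =
      if i = 0 ∨ i = Fin.last (m + 1) then 1 else 2 := by
  split_ifs with h
  · rw [Set.ncard_eq_one]
    rcases h with rfl | rfl
    · refine ⟨⟨1, by omega⟩, ?_⟩
      ext j
      simp only [mem_neighborSet, pathGraph_adj, Set.mem_singleton_iff, Fin.ext_iff, Fin.val_zero]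
      omega
    · refine ⟨⟨m, by omega⟩, ?_⟩
      ext j
      simp only [mem_neighborSet, pathGraph_adj, Set.mem_singleton_iff, Fin.ext_iff, Fin.val_last]
      omega
  · simp only [Fin.ext_iff, Fin.val_zero, Fin.val_last] at h
    rw [Set.ncard_eq_two]
    refine ⟨⟨i - 1, by omega⟩, ⟨i + 1, by omega⟩, by simp [Fin.ext_iff], ?_⟩
    ext j
    simp only [mem_neighborSet, pathGraph_adj, Set.mem_singleton_iff, Set.mem_insert_iff,
      Fin.ext_iff]
    omega

theorem classB_counts {V : Type*} {G : SimpleGraph V} (h : ClassB G) :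
    (degreeClass G 1).ncard = G.indepNum ∧ (degreeClass G 2).ncard = 2 ∧
      (degreeClass G 3).ncard + 2 = G.indepNum := by
  obtain ⟨n, hn, ⟨e⟩⟩ := h
  obtain ⟨m, rfl⟩ := Nat.exists_eq_add_of_le' hn
  simp only [e.ncard_degreeClass, e.indepNum_eq, indepNum_pendantPath]
  have hdeg : ∀ i : Fin (m + 2), ((pendantPath (m + 2)).neighborSet (Sum.inl i)).ncard =
      if i = 0 ∨ i = Fin.last (m + 1) then 2 else 3 := by
    intro i
    rw [ncard_neighborSet_pendantPath_inl, ncard_neighborSet_pathGraph]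
    split_ifs <;> rfl
  have h1 : degreeClass (pendantPath (m + 2)) 1 = Sum.inr '' Set.univ := by
    ext (i | i)
    · simp only [degreeClass, Set.mem_ofPred_eq, hdeg]
      split_ifs <;> simp
    · simp [-Set.ncard_eq_one, degreeClass, ncard_neighborSet_pendantPath_inr]
  have h2 : degreeClass (pendantPath (m + 2)) 2 = Sum.inl '' {0, Fin.last (m + 1)} := by
    ext (i | i)
    · simp only [degreeClass, Set.mem_ofPred_eq, hdeg]
      split_ifs with h <;> simp [h, eq_comm]
    · simp [degreeClass, ncard_neighborSet_pendantPath_inr]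
  have h3 : degreeClass (pendantPath (m + 2)) 3 = Sum.inl '' {0, Fin.last (m + 1)}ᶜ := by
    ext (i | i)
    · simp only [degreeClass, Set.mem_ofPred_eq, hdeg]
      split_ifs with h <;> simp [eq_comm] <;> grind
    · simp [degreeClass, ncard_neighborSet_pendantPath_inr]
  have hpair : ({0, Fin.last (m + 1)} : Set (Fin (m + 2))).ncard = 2 :=
    Set.ncard_pair (by simp [Fin.ext_iff])
  have hcompl := Set.ncard_add_ncard_compl ({0, Fin.last (m + 1)} : Set (Fin (m + 2)))
  rw [hpair, Nat.card_fin] at hcompl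
  rw [h1, h2, h3, Set.ncard_image_of_injective _ Sum.inl_injective,
    Set.ncard_image_of_injective _ Sum.inr_injective,
    Set.ncard_image_of_injective _ Sum.inl_injective, hpair, Set.ncard_univ, Nat.card_fin]
  omega

end PendantPath

end SimpleGraph

open SimpleGraph

theorem degreeBound_le_indepNum {V : Type*} {G : SimpleGraph V} (hG : ClassG G) {c₁ : ℝ}
    (h₁ : 2 / 3 ≤ c₁) (h₂ : c₁ ≤ 5 / 7) :
    degreeBound c₁ (2 * c₁ - 1) (1 - c₁) (6 * c₁ - 4) G ≤ G.indepNum := by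
  obtain ⟨hI, hII, -⟩ := indepNum_bounds_of_classG hG
  have hI' := (Nat.cast_le (α := ℝ)).2 hI
  have hII' := (Nat.cast_le (α := ℝ)).2 hII
  push_cast at hI' hII'
  have h3 := mul_le_mul_of_nonneg_left hI' (by linarith : 0 ≤ 5 / 7 - c₁)
  have h4 := mul_le_mul_of_nonneg_left hII' (by linarith : 0 ≤ c₁ - 2 / 3)
  unfold degreeBound
  linarith

theorem degreeBound_le_indepNum_of_ge {V : Type*} {G : SimpleGraph V} (hG : ClassG G) {c₁ : ℝ}
    (h₁ : 5 / 7 ≤ c₁) :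
    degreeBound c₁ (3 / 7) (1 - c₁) (2 * c₁ - 8 / 7) G ≤ G.indepNum := by
  obtain ⟨-, hII, hIII⟩ := indepNum_bounds_of_classG hG
  have hII' := (Nat.cast_le (α := ℝ)).2 hII
  have hIII' := (Nat.cast_le (α := ℝ)).2 hIII
  push_cast at hII' hIII'
  have h3 := mul_le_mul_of_nonneg_left hIII' (by linarith : 0 ≤ c₁ - 5 / 7)
  unfold degreeBound
  linarith

theorem indepNum_eq_degreeBound_of_classA {V : Type u} {G : SimpleGraph V} (hG : ClassA G)
    (c₁ : ℝ) : (G.indepNum : ℝ) = degreeBound c₁ (2 * c₁ - 1) (1 - c₁) (6 * c₁ - 4) G := by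
  obtain ⟨-, h1, h2, h3⟩ := classA_counts hG
  have h2' := congrArg (Nat.cast (R := ℝ)) h2
  have h3' := congrArg (Nat.cast (R := ℝ)) h3
  push_cast at h2' h3'
  rw [degreeBound, h1, h2', eq_sub_of_add_eq h3']
  push_cast
  ring

theorem indepNum_eq_degreeBound_of_classB {V : Type*} {G : SimpleGraph V} (hG : ClassB G)
    (c₁ c₂ : ℝ) :
    (G.indepNum : ℝ) = degreeBound c₁ c₂ (1 - c₁) (2 * c₁ + 2 * c₂ - 2) G := by
  obtain ⟨h1, h2, h3⟩ := classB_counts hG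
  have h3' := congrArg (Nat.cast (R := ℝ)) h3
  push_cast at h3'
  rw [degreeBound, h1, h2, eq_sub_of_add_eq h3']
  push_cast
  ring

theorem corollary5 :
    (∀ c₁ : ℝ, 2 / 3 ≤ c₁ → c₁ ≤ 5 / 7 →
      (c₁, 2 * c₁ - 1) ∈ SAB.{u} ∧
      (∀ (V : Type u) (G : SimpleGraph V), ClassG G →
        (G.indepNum : ℝ) ≥ degreeBound c₁ (2 * c₁ - 1) (1 - c₁) (6 * c₁ - 4) G) ∧
      (∀ (V : Type u) (G : SimpleGraph V), ClassA G ∨ ClassB G →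
        (G.indepNum : ℝ) = degreeBound c₁ (2 * c₁ - 1) (1 - c₁) (6 * c₁ - 4) G)) ∧
    (∀ c₁ : ℝ, 5 / 7 ≤ c₁ → c₁ ≤ 1 →
      (c₁, 3 / 7) ∈ SB.{u} ∧
      (∀ (V : Type u) (G : SimpleGraph V), ClassB G →
        (G.indepNum : ℝ) = degreeBound c₁ (3 / 7) (1 - c₁) (2 * c₁ - 8 / 7) G)) := by
  refine ⟨fun c₁ h₁ h₂ => ⟨⟨⟨fun V G hG => ?_, fun V G hG => ?_⟩, rfl⟩,
    fun V G hG => degreeBound_le_indepNum hG h₁ h₂, fun V G hG => ?_⟩,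
    fun c₁ h₁ _ => ⟨fun V G hG => ?_, fun V G hG => ?_⟩⟩
  · have := degreeBound_le_indepNum hG h₁ h₂
    unfold degreeBound at *
    linarith
  · have := degreeBound_le_indepNum hG h₁ h₂
    unfold degreeBound at *
    linarith
  · rcases hG with hG | hG
    · exact indepNum_eq_degreeBound_of_classA hG c₁
    · rw [indepNum_eq_degreeBound_of_classB hG c₁ (2 * c₁ - 1)]
      unfold degreeBound
      ring
  · have := degreeBound_le_indepNum_of_ge hG h₁
    unfold degreeBound at *
    linarith
  · rw [indepNum_eq_degreeBound_of_classB hG c₁ (3 / 7)]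
    unfold degreeBound
    ring
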